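/- Regard $\mathbb{C}^k$ as a commutative algebra with coordinatewise product and unit $e=(1,\dots,1)$. A Banach algebra norm on $\mathbb{C}^k$ means a vector space norm with $\|v\cdot w\|\le\|v\|\,\|w\|$ for all $v,w$ and $\|e\|=1$; its unit ball is $\{v:\|v\|\le 1\}$. Let $\mathcal{O}_k$ be the set of unit balls of those Banach algebra norms on $\mathbb{C}^k$ for which there are a complex Hilbert space $H$ and a unital algebra homomorphism $\pi:\mathbb{C}^k\to B(H)$ with $\|\pi(v)\|=\|v\|$ for all $v$. Let $\mathcal{H}_k$ (the hyperconvex sets) be the set of unit balls of those Banach algebra norms on $\mathbb{C}^k$ that satisfy the multi-variable von Neumann inequality: for every $n$, all $a_1,\dots,a_n$ with $\|a_j\|\le 1$, and every polynomial $p$ in $n$ variables with complex coefficients, $\|p(a_1,\dots,a_n)\|\le\sup\{|p(z_1,\dots,z_n)|:|z_i|\le 1,\ 1\le i\le n\}$. For a subset $D$ of the closed unit polydisk $\{v\in\mathbb{C}^k:|v_i|\le 1 \text{ for all } i\}$, let $\mathcal{O}(D)$ be the intersection of all elements of $\mathcal{O}_k$ that contain $D$, and let $\mathcal{H}(D)$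 be the intersection of all elements of $\mathcal{H}_k$ that contain $D$. Corollary 2.36. Let $D\subseteq\mathbb{C}^k$ be contained in the closed unit polydisk. If $D$ consists of two or fewer points, then $\mathcal{O}(D)=\mathcal{H}(D)$. -/

import Mathlib

/-- The closed unit polydisk in `ℂⁿ`. -/
def closedPolydisk (n : ℕ) : Set (Fin n → ℂ) :=
  {z | ∀ i, ‖z i‖ ≤ 1}

/-- The supremum norm of a polynomial in `n` variables over the closed unit polydisk. -/
noncomputable def polydiskNorm {n : ℕ} (p : MvPolynomial (Fin n) ℂ) : ℝ :=
  sSup ((fun z : Fin n → ℂ => ‖MvPolynomial.eval z p‖) '' closedPolydisk n)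

/-- The supremum in `polydiskNorm` is over a bounded set. -/
theorem bddAbove_polydiskNorm {n : ℕ} (p : MvPolynomial (Fin n) ℂ) :
    BddAbove ((fun z : Fin n → ℂ => ‖MvPolynomial.eval z p‖) '' closedPolydisk n) := by
  have h : closedPolydisk n = Set.univ.pi fun _ => Metric.closedBall (0 : ℂ) 1 := by
    ext z
    simp [closedPolydisk, Set.mem_pi]
  rw [h]
  exact ((isCompact_univ_pi fun _ => isCompact_closedBall (0 : ℂ) 1).image
    (MvPolynomial.continuous_eval p).norm).bddAbove

/-- The closed unit ball of a norm on the algebra `ℂᵏ` (with coordinatewise product). Here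
`AlgebraNorm` means a complex vector space norm which is submultiplicative. -/
def algebraBall {k : ℕ} (N : AlgebraNorm ℂ (Fin k → ℂ)) : Set (Fin k → ℂ) :=
  {v | N v ≤ 1}

/-- The multi-variable von Neumann inequality for a norm on `ℂᵏ`: for every `n`, all `n`-tuples
in the unit ball, and all polynomials `p` in `n` variables, `‖p(a₁, …, aₙ)‖ ≤ ‖p‖_∞`. -/
def SatisfiesMultivariableVonNeumann {k : ℕ} (N : AlgebraNorm ℂ (Fin k → ℂ)) : Prop :=
  ∀ (n : ℕ) (a : Fin n → Fin k → ℂ), (∀ j, N (a j) ≤ 1) →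
    ∀ p : MvPolynomial (Fin n) ℂ, N (MvPolynomial.aeval a p) ≤ polydiskNorm p

/-- The norm `N` makes `ℂᵏ` into an algebra having a unital isometric representation on a
Hilbert space. (Restricting a representation of the finite dimensional algebra `ℂᵏ` to a suitable
separable invariant subspace keeps it isometric, so Hilbert spaces in `Type` suffice.) -/
def HasHilbertRepresentation {k : ℕ} (N : AlgebraNorm ℂ (Fin k → ℂ)) : Prop :=
  ∃ (H : Type) (_ : NormedAddCommGroup H) (_ : InnerProductSpace ℂ H) (_ : CompleteSpace H)
    (π : (Fin k → ℂ) →ₐ[ℂ] (H →L[ℂ] H)), ∀ v, ‖π v‖ = N v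

/-- The family of operator algebra balls: unit balls of Banach algebra norms on `ℂᵏ` with
`‖e‖ = 1` that have a unital isometric representation on a Hilbert space. -/
def operatorAlgebraBalls (k : ℕ) : Set (Set (Fin k → ℂ)) :=
  {B | ∃ N : AlgebraNorm ℂ (Fin k → ℂ),
    N 1 = 1 ∧ HasHilbertRepresentation N ∧ B = algebraBall N}

/-- The family of hyperconvex sets: unit balls of Banach algebra norms on `ℂᵏ` with `‖e‖ = 1`
that satisfy the multi-variable von Neumann inequality. -/
def hyperconvexBalls (k : ℕ) : Set (Set (Fin k → ℂ)) :=
  {B | ∃ N : AlgebraNorm ℂ (Fin k → ℂ),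
    N 1 = 1 ∧ SatisfiesMultivariableVonNeumann N ∧ B = algebraBall N}

/-- `𝒪(D)`: the intersection of all operator algebra balls containing `D`. -/
def operatorAlgebraBallGen {k : ℕ} (D : Set (Fin k → ℂ)) : Set (Fin k → ℂ) :=
  ⋂₀ {B | B ∈ operatorAlgebraBalls k ∧ D ⊆ B}

/-- `ℋ(D)`: the intersection of all hyperconvex sets containing `D`. -/
def hyperconvexBallGen {k : ℕ} (D : Set (Fin k → ℂ)) : Set (Fin k → ℂ) :=
  ⋂₀ {B | B ∈ hyperconvexBalls k ∧ D ⊆ B}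

/-! Both hulls are compared through quotient norms of polynomials on the polydisk. Write `g` for a
tuple that contains `a`, `b` and small multiples of the coordinate idempotents; the idempotents
ensure that polynomials in `g` exhaust `ℂᵏ`.

`hyperconvexBallGen_subset`: the quotient norm `inf {‖p‖_∞ : p(g) = w}` is hyperconvex, so a point
`v` of the hyperconvex hull is `p(g)` with `‖p‖_∞` close to `1`. Setting the extra variables to `0`
gives a polynomial in `a` and `b` alone, which Ando's inequality bounds in every operator algebra
norm; the number two enters here. By the Schwarz lemma the substitution costs little, and the cost
vanishes as the idempotents are scaled to `0`.

`operatorAlgebraBallGen_subset`: suppose a hyperconvex norm has `N v > 1`, and let a functional `φ`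
of norm at most one satisfy `φ v = N v`. By the von Neumann inequality and Hahn–Banach
(`exists_state_norm_sq_le`) there is a state `m` with `|φ(p(g))|² ≤ m(|p|²)`. The quotient of the
`L²(m)` seminorm is a Hilbertian seminorm on `ℂᵏ` for which multiplication by each `g j` is a
contraction. Made definite by a small Euclidean term, it represents `ℂᵏ` with `a` and `b`
contractive and `‖π v‖ > 1`. -/

open MvPolynomial

/-! ### Supremum norm of polynomials on the polydisk. -/

section PolydiskNorm

variable {n : ℕ}

theorem zero_mem_closedPolydisk (n : ℕ) : (0 : Fin n → ℂ) ∈ closedPolydisk n := fun i => by simp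

theorem isCompact_closedPolydisk (n : ℕ) : IsCompact (closedPolydisk n) := by
  have h : closedPolydisk n = Set.univ.pi fun _ => Metric.closedBall (0 : ℂ) 1 := by
    ext z
    simp [closedPolydisk, Set.mem_pi]
  rw [h]
  exact isCompact_univ_pi fun _ => isCompact_closedBall (0 : ℂ) 1

theorem norm_eval_le_polydiskNorm (p : MvPolynomial (Fin n) ℂ) {z : Fin n → ℂ}
    (hz : z ∈ closedPolydisk n) : ‖eval z p‖ ≤ polydiskNorm p :=
  le_csSup (bddAbove_polydiskNorm p) ⟨z, hz, rfl⟩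

theorem polydiskNorm_le {p : MvPolynomial (Fin n) ℂ} {c : ℝ}
    (h : ∀ z ∈ closedPolydisk n, ‖eval z p‖ ≤ c) : polydiskNorm p ≤ c := by
  refine csSup_le ⟨_, 0, zero_mem_closedPolydisk n, rfl⟩ ?_
  rintro _ ⟨z, hz, rfl⟩
  exact h z hz

theorem polydiskNorm_nonneg (p : MvPolynomial (Fin n) ℂ) : 0 ≤ polydiskNorm p :=
  (norm_nonneg _).trans (norm_eval_le_polydiskNorm p (zero_mem_closedPolydisk n))

theorem polydiskNorm_add_le (p q : MvPolynomial (Fin n) ℂ) :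
    polydiskNorm (p + q) ≤ polydiskNorm p + polydiskNorm q :=
  polydiskNorm_le fun z hz => by
    rw [map_add]
    exact (norm_add_le _ _).trans
      (add_le_add (norm_eval_le_polydiskNorm p hz) (norm_eval_le_polydiskNorm q hz))

theorem polydiskNorm_mul_le (p q : MvPolynomial (Fin n) ℂ) :
    polydiskNorm (p * q) ≤ polydiskNorm p * polydiskNorm q :=
  polydiskNorm_le fun z hz => by
    rw [map_mul, norm_mul]
    exact mul_le_mul (norm_eval_le_polydiskNorm p hz) (norm_eval_le_polydiskNorm q hz)
      (norm_nonneg _) (polydiskNorm_nonneg p)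

theorem polydiskNorm_smul_le (c : ℂ) (p : MvPolynomial (Fin n) ℂ) :
    polydiskNorm (c • p) ≤ ‖c‖ * polydiskNorm p :=
  polydiskNorm_le fun z hz => by
    rw [smul_eval, norm_mul]
    exact mul_le_mul_of_nonneg_left (norm_eval_le_polydiskNorm p hz) (norm_nonneg _)

/-- The tuple `P` maps the polydisk into a polydisk, so values of the composite are values of `q`
there. -/
theorem polydiskNorm_aeval_le {m : ℕ} (q : MvPolynomial (Fin m) ℂ)
    (P : Fin m → MvPolynomial (Fin n) ℂ) (hP : ∀ j, polydiskNorm (P j) ≤ 1) :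
    polydiskNorm (aeval P q) ≤ polydiskNorm q :=
  polydiskNorm_le fun z hz => by
    have h : eval z (aeval P q) = eval (fun j => eval z (P j)) q := by
      rw [← coe_aeval_eq_eval z, RingHom.coe_coe, ← AlgHom.comp_apply, comp_aeval,
        ← coe_aeval_eq_eval]
      rfl
    rw [h]
    exact norm_eval_le_polydiskNorm q fun j => (norm_eval_le_polydiskNorm (P j) hz).trans (hP j)

end PolydiskNorm

theorem aeval_pi_apply {n k : ℕ} (g : Fin n → Fin k → ℂ) (p : MvPolynomial (Fin n) ℂ)
    (i : Fin k) : aeval g p i = eval (fun j => g j i) p := by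
  have := comp_aeval g (Pi.evalAlgHom ℂ (fun _ : Fin k => ℂ) i)
  have := DFunLike.congr_fun this p
  rw [← coe_aeval_eq_eval]
  exact this

/-- Comparison with the sup norm, by expanding in coordinate idempotents; it turns coordinatewise
error estimates into estimates for `N`. -/
theorem AlgebraNorm.le_mul_sup {k : ℕ} (N : AlgebraNorm ℂ (Fin k → ℂ)) (x : Fin k → ℂ) {c : ℝ}
    (hc : ∀ i, ‖x i‖ ≤ c) : N x ≤ (∑ i, N (Pi.single i 1)) * c := by
  have hx : x = ∑ i, x i • Pi.single i (1 : ℂ) := by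
    ext j
    simp [Finset.sum_apply, Pi.single_apply]
  calc N x = N (∑ i, x i • Pi.single i (1 : ℂ)) := by rw [← hx]
    _ ≤ ∑ i, N (x i • Pi.single i (1 : ℂ)) :=
      Finset.le_sum_of_subadditive N (map_zero N).le (map_add_le_add N) _ _
    _ ≤ ∑ i, N (Pi.single i 1) * c := by
      refine Finset.sum_le_sum fun i _ => ?_
      rw [map_smul_eq_mul, mul_comm]
      exact mul_le_mul_of_nonneg_left (hc i) (apply_nonneg N _)
    _ = _ := by rw [Finset.sum_mul]

/-! ### Quotients of the polydisk algebra are hyperconvex. -/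

section QuotientNorm

variable {n k : ℕ}

/-- The quotient norm on `ℂᵏ` induced by the supremum norm of polynomials on the polydisk and
evaluation at the tuple `g`. -/
noncomputable def quotientNorm (g : Fin n → Fin k → ℂ) (w : Fin k → ℂ) : ℝ :=
  ⨅ p : {p : MvPolynomial (Fin n) ℂ // aeval g p = w}, polydiskNorm p.1

variable {g : Fin n → Fin k → ℂ}

theorem quotientNorm_aeval_le (g : Fin n → Fin k → ℂ) (p : MvPolynomial (Fin n) ℂ) :
    quotientNorm g (aeval g p) ≤ polydiskNorm p :=
  ciInf_le ⟨0, by rintro _ ⟨q, rfl⟩; exact polydiskNorm_nonneg _⟩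
    (⟨p, rfl⟩ : {q : MvPolynomial (Fin n) ℂ // aeval g q = aeval g p})

theorem exists_of_quotientNorm_lt
    (hs : Function.Surjective (aeval g : MvPolynomial (Fin n) ℂ →ₐ[ℂ] (Fin k → ℂ)))
    {w : Fin k → ℂ} {c : ℝ} (h : quotientNorm g w < c) :
    ∃ p : MvPolynomial (Fin n) ℂ, aeval g p = w ∧ polydiskNorm p < c := by
  obtain ⟨p, hp⟩ := hs w
  have : Nonempty {p : MvPolynomial (Fin n) ℂ // aeval g p = w} := ⟨⟨p, hp⟩⟩
  obtain ⟨⟨q, hq⟩, hlt⟩ := exists_lt_of_ciInf_lt h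
  exact ⟨q, hq, hlt⟩

theorem quotientNorm_nonneg (g : Fin n → Fin k → ℂ) (w : Fin k → ℂ) : 0 ≤ quotientNorm g w :=
  Real.iInf_nonneg fun _ => polydiskNorm_nonneg _

theorem quotientNorm_smul_le
    (hs : Function.Surjective (aeval g : MvPolynomial (Fin n) ℂ →ₐ[ℂ] (Fin k → ℂ)))
    (c : ℂ) (w : Fin k → ℂ) : quotientNorm g (c • w) ≤ ‖c‖ * quotientNorm g w := by
  refine le_of_forall_pos_le_add fun ε hε => ?_
  obtain ⟨p, rfl, hp⟩ := exists_of_quotientNorm_lt hs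
    (lt_add_of_pos_right (quotientNorm g w) (by positivity : 0 < ε / (‖c‖ + 1)))
  rw [← map_smul]
  refine (quotientNorm_aeval_le g _).trans ((polydiskNorm_smul_le c p).trans ?_)
  refine (mul_le_mul_of_nonneg_left hp.le (norm_nonneg c)).trans ?_
  rw [mul_add]
  gcongr
  rw [mul_div_assoc', div_le_iff₀ (by positivity)]
  nlinarith [norm_nonneg c]

/-- The `i`-th coordinate of `p(g)` is the value of `p` at a point of the polydisk. This gives
definiteness and the lower bound for the norm of the unit. -/
theorem norm_apply_le_quotientNorm (hg : ∀ j, g j ∈ closedPolydisk k)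
    (hs : Function.Surjective (aeval g : MvPolynomial (Fin n) ℂ →ₐ[ℂ] (Fin k → ℂ)))
    (w : Fin k → ℂ) (i : Fin k) : ‖w i‖ ≤ quotientNorm g w := by
  refine le_of_forall_gt fun c hc => ?_
  obtain ⟨p, rfl, hp⟩ := exists_of_quotientNorm_lt hs hc
  rw [aeval_pi_apply]
  exact (norm_eval_le_polydiskNorm p fun j => hg j i).trans_lt hp

/-- The quotient norm as an algebra norm. -/
noncomputable def quotientAlgebraNorm (hg : ∀ j, g j ∈ closedPolydisk k)
    (hs : Function.Surjective (aeval g : MvPolynomial (Fin n) ℂ →ₐ[ℂ] (Fin k → ℂ))) :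
    AlgebraNorm ℂ (Fin k → ℂ) where
  toFun := quotientNorm g
  map_zero' := le_antisymm (by
    have := quotientNorm_smul_le hs 0 0
    simpa using this) (quotientNorm_nonneg _ _)
  add_le' x y := by
    refine le_of_forall_pos_le_add fun ε hε => ?_
    obtain ⟨p, rfl, hp⟩ := exists_of_quotientNorm_lt hs
      (lt_add_of_pos_right (quotientNorm g x) (half_pos hε))
    obtain ⟨q, rfl, hq⟩ := exists_of_quotientNorm_lt hs
      (lt_add_of_pos_right (quotientNorm g y) (half_pos hε))
    rw [← map_add]
    linarith [quotientNorm_aeval_le g (p + q), polydiskNorm_add_le p q]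
  neg' x := by
    have h : ∀ y, quotientNorm g (-y) ≤ quotientNorm g y := fun y => by
      simpa using quotientNorm_smul_le hs (-1) y
    exact le_antisymm (h x) (by simpa using h (-x))
  mul_le' x y := by
    refine le_of_forall_gt fun c hc => ?_
    have hcont : Filter.Tendsto
        (fun ε : ℝ => (quotientNorm g x + ε) * (quotientNorm g y + ε)) (nhdsWithin 0 (Set.Ioi 0))
        (nhds (quotientNorm g x * quotientNorm g y)) := by
      have : Continuous fun ε : ℝ => (quotientNorm g x + ε) * (quotientNorm g y + ε) := by
        fun_prop
      exact (this.tendsto' 0 _ (by simp)).mono_left nhdsWithin_le_nhds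
    obtain ⟨ε, hε, hε0⟩ := ((hcont.eventually_lt_const hc).and self_mem_nhdsWithin).exists
    obtain ⟨p, rfl, hp⟩ := exists_of_quotientNorm_lt hs
      (lt_add_of_pos_right (quotientNorm g x) hε0)
    obtain ⟨q, rfl, hq⟩ := exists_of_quotientNorm_lt hs
      (lt_add_of_pos_right (quotientNorm g y) hε0)
    rw [← map_mul]
    refine lt_of_le_of_lt ((quotientNorm_aeval_le g _).trans (polydiskNorm_mul_le p q)) ?_
    exact (mul_le_mul hp.le hq.le (polydiskNorm_nonneg q)
      ((polydiskNorm_nonneg p).trans hp.le)).trans_lt hε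
  eq_zero_of_map_eq_zero' x hx := by
    ext i
    have := norm_apply_le_quotientNorm hg hs x i
    exact norm_le_zero_iff.1 (this.trans hx.le)
  smul' c x := by
    refine le_antisymm (quotientNorm_smul_le hs c x) ?_
    rcases eq_or_ne c 0 with rfl | hc
    · simpa using quotientNorm_nonneg g _
    · have := quotientNorm_smul_le hs c⁻¹ (c • x)
      rw [smul_smul, inv_mul_cancel₀ hc, one_smul, norm_inv] at this
      rwa [inv_mul_eq_div, le_div_iff₀ (norm_pos_iff.2 hc), mul_comm] at this

theorem quotientAlgebraNorm_apply (hg : ∀ j, g j ∈ closedPolydisk k)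
    (hs : Function.Surjective (aeval g : MvPolynomial (Fin n) ℂ →ₐ[ℂ] (Fin k → ℂ)))
    (w : Fin k → ℂ) : quotientAlgebraNorm hg hs w = quotientNorm g w := rfl

theorem quotientNorm_one [NeZero k] (hg : ∀ j, g j ∈ closedPolydisk k)
    (hs : Function.Surjective (aeval g : MvPolynomial (Fin n) ℂ →ₐ[ℂ] (Fin k → ℂ))) :
    quotientNorm g 1 = 1 := by
  refine le_antisymm ?_ (by simpa using norm_apply_le_quotientNorm hg hs 1 0)
  have := quotientNorm_aeval_le g 1
  rw [map_one] at this
  exact this.trans (polydiskNorm_le fun z _ => by simp)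

theorem quotientNorm_generator_le (g : Fin n → Fin k → ℂ) (j : Fin n) :
    quotientNorm g (g j) ≤ 1 := by
  have := quotientNorm_aeval_le g (X j)
  rw [aeval_X] at this
  exact this.trans (polydiskNorm_le fun z hz => by simpa using hz j)

/-- For `0 < t < 1` each `t • a j` has norm below one and lifts to a polynomial `P j` bounded by one
on the polydisk; `q ∘ P` then lifts `q(t • a)`. Letting `t → 1` finishes, since the quotient infimum
need not be attained. -/
theorem satisfiesMultivariableVonNeumann_quotientAlgebraNorm (hg : ∀ j, g j ∈ closedPolydisk k)
    (hs : Function.Surjective (aeval g : MvPolynomial (Fin n) ℂ →ₐ[ℂ] (Fin k → ℂ))) :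
    SatisfiesMultivariableVonNeumann (quotientAlgebraNorm hg hs) := by
  intro m a ha q
  set N := quotientAlgebraNorm hg hs with hN
  have hlt : ∀ t : ℝ, t ∈ Set.Ioo (0 : ℝ) 1 →
      N (aeval (fun j => (t : ℂ) • a j) q) ≤ polydiskNorm q := by
    intro t ht
    have h1 : ∀ j, quotientNorm g ((t : ℂ) • a j) < 1 := fun j => by
      refine (quotientNorm_smul_le hs _ _).trans_lt ?_
      have := ha j
      rw [hN, quotientAlgebraNorm_apply] at this
      rw [Complex.norm_real, Real.norm_of_nonneg ht.1.le]
      nlinarith [ht.1, ht.2]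
    choose P hP hP1 using fun j => exists_of_quotientNorm_lt hs (h1 j)
    have h2 : aeval (fun j => (t : ℂ) • a j) q = aeval g (aeval P q) := by
      rw [← AlgHom.comp_apply, comp_aeval]
      simp only [hP]
    rw [h2]
    exact (quotientNorm_aeval_le g _).trans (polydiskNorm_aeval_le q P fun j => (hP1 j).le)
  have hc : Filter.Tendsto (fun t : ℝ => polydiskNorm q + (∑ i, N (Pi.single i 1)) *
      ‖aeval a q - aeval (fun j => (t : ℂ) • a j) q‖) (nhdsWithin 1 (Set.Iio 1))
      (nhds (polydiskNorm q)) := by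
    have : Continuous fun t : ℝ => polydiskNorm q + (∑ i, N (Pi.single i 1)) *
        ‖aeval a q - aeval (fun j => (t : ℂ) • a j) q‖ := by
      refine continuous_const.add (continuous_const.mul (continuous_const.sub ?_).norm)
      refine continuous_pi fun i => ?_
      simp only [aeval_pi_apply]
      refine (MvPolynomial.continuous_eval q).comp (continuous_pi fun j => ?_)
      exact (Complex.continuous_ofReal.smul continuous_const)
    exact (this.tendsto' 1 _ (by simp)).mono_left nhdsWithin_le_nhds
  refine ge_of_tendsto hc ?_
  filter_upwards [Ioo_mem_nhdsLT (show (0 : ℝ) < 1 by norm_num)] with t ht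
  calc N (aeval a q) = N (aeval (fun j => (t : ℂ) • a j) q +
        (aeval a q - aeval (fun j => (t : ℂ) • a j) q)) := by congr 1; abel
    _ ≤ _ := (map_add_le_add N _ _).trans (add_le_add (hlt t ht)
        (N.le_mul_sup _ fun i => norm_le_pi_norm _ i))

end QuotientNorm

/-! ### Von Neumann's inequality for two commuting isometries, by finite Fourier analysis. -/

section CommutingIsometries

variable {K : Type*} [NormedAddCommGroup K] [InnerProductSpace ℂ K]

/-- Parseval's identity for vector valued functions on a finite abelian group. -/
theorem sum_addChar_norm_sq {G : Type*} [AddCommGroup G] [Fintype G] (X : G → K) :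
    ∑ ψ : AddChar G ℂ, ‖∑ a, ψ a • X a‖ ^ 2 = Fintype.card G * ∑ a, ‖X a‖ ^ 2 := by
  classical
  have key : ((∑ ψ : AddChar G ℂ, ‖∑ a, ψ a • X a‖ ^ 2 : ℝ) : ℂ) =
      ((Fintype.card G * ∑ a, ‖X a‖ ^ 2 : ℝ) : ℂ) := by
    push_cast
    have h1 : ∀ ψ : AddChar G ℂ, (‖∑ a, ψ a • X a‖ : ℂ) ^ 2 =
        ∑ a, ∑ b, ψ (b - a) * inner ℂ (X a) (X b) := fun ψ => by
      refine (inner_self_eq_norm_sq_to_K (𝕜 := ℂ) (∑ a, ψ a • X a)).symm.trans ?_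
      rw [sum_inner]
      refine Finset.sum_congr rfl fun a _ => ?_
      rw [inner_sum]
      refine Finset.sum_congr rfl fun b _ => ?_
      rw [inner_smul_left, inner_smul_right, ← mul_assoc, sub_eq_neg_add, AddChar.map_add_eq_mul,
        AddChar.map_neg_eq_conj]
    simp only [h1]
    rw [Finset.sum_comm, Finset.mul_sum]
    refine Finset.sum_congr rfl fun a _ => ?_
    rw [Finset.sum_comm]
    simp only [← Finset.sum_mul, AddChar.sum_apply_eq_ite]
    rw [Finset.sum_eq_single a]
    · simp [inner_self_eq_norm_sq_to_K]
    · intro b _ hb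
      rw [if_neg (by simpa [sub_eq_zero] using hb), zero_mul]
    · simp
  exact_mod_cast key

/-- A trigonometric convolution operator on a finite abelian group is bounded by the supremum
norm of its symbol. -/
theorem sum_norm_sq_convolution_le {G : Type*} [AddCommGroup G] [Fintype G] {n : ℕ}
    (e : Fin n → G) (p : MvPolynomial (Fin n) ℂ) (X : G → K) :
    ∑ a, ‖∑ m ∈ p.support, coeff m p • X (a + ∑ j, m j • e j)‖ ^ 2 ≤
      polydiskNorm p ^ 2 * ∑ a, ‖X a‖ ^ 2 := by
  -- Characters diagonalise the convolution: its symbol at `ψ` is `p` evaluated at `(ψ (-e j))`, a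
  -- point with unimodular coordinates.
  have h1 : ∀ ψ : AddChar G ℂ,
      ∑ a, ψ a • ∑ m ∈ p.support, coeff m p • X (a + ∑ j, m j • e j) =
        eval (fun j => ψ (-e j)) p • ∑ a, ψ a • X a := fun ψ => by
    simp only [Finset.smul_sum]
    rw [Finset.sum_comm]
    simp only [← Finset.smul_sum]
    rw [eval_eq', Finset.sum_smul]
    refine Finset.sum_congr rfl fun m _ => ?_
    rw [mul_smul, Finset.smul_sum, Finset.smul_sum]
    refine Fintype.sum_equiv (Equiv.addRight (∑ j, m j • e j)) _ _ fun a => ?_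
    rw [smul_comm, Equiv.coe_addRight, smul_smul (∏ _, _)]
    congr 2
    have h2 : ∏ j, ψ (-e j) ^ m j = ψ (-∑ j, m j • e j) := by
      rw [← Finset.sum_neg_distrib]
      refine (Finset.prod_congr rfl fun j _ => ?_).trans
        (map_prod ψ.toMonoidHom (fun j => Multiplicative.ofAdd (-(m j • e j))) Finset.univ).symm
      rw [AddChar.toMonoidHom_apply, toAdd_ofAdd, ← smul_neg, AddChar.map_nsmul_eq_pow]
    rw [h2, ← AddChar.map_add_eq_mul]
    rw [add_comm, add_neg_cancel_right]
  have hcard : (0 : ℝ) < Fintype.card G := by exact_mod_cast Fintype.card_pos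
  refine le_of_mul_le_mul_left ?_ hcard
  rw [← sum_addChar_norm_sq, mul_left_comm, ← sum_addChar_norm_sq, Finset.mul_sum]
  refine Finset.sum_le_sum fun ψ _ => ?_
  rw [h1, norm_smul, mul_pow]
  gcongr
  exact norm_eval_le_polydiskNorm p fun j => by simp

/-- The von Neumann inequality for a commuting pair of isometries. -/
theorem norm_sum_isometry_le (V W : K →ₗᵢ[ℂ] K) (hVW : ∀ x, V (W x) = W (V x))
    (p : MvPolynomial (Fin 2) ℂ) (x : K) :
    ‖∑ m ∈ p.support, coeff m p • V^[m 0] (W^[m 1] x)‖ ≤ polydiskNorm p * ‖x‖ := by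
  set y := ∑ m ∈ p.support, coeff m p • V^[m 0] (W^[m 1] x) with hy
  obtain ⟨d, hd⟩ : ∃ d : ℕ, ∀ m ∈ p.support, m 0 ≤ d ∧ m 1 ≤ d :=
    ⟨p.totalDegree, fun m hm => by
      have h := le_totalDegree hm
      rw [Finsupp.sum_fintype _ _ (by simp), Fin.sum_univ_two] at h
      omega⟩
  have hpow : ∀ (U : K →ₗᵢ[ℂ] K) (i : ℕ) (z : K), ‖U^[i] z‖ = ‖z‖ := fun U i z => by
    induction i generalizing z with
    | zero => rfl
    | succ i ih => rw [Function.iterate_succ_apply, ih, U.norm_map]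
  have hcomm : ∀ (i j : ℕ) (z : K), V^[i] (W^[j] z) = W^[j] (V^[i] z) := fun i j z =>
    (Function.Commute.iterate_iterate (f := V) (g := W) hVW i j) z
  -- The orbit `V^i W^j x` is placed on a cyclic group of side `N + d`. Since exponents of `p` are
  -- at most `d`, translates from the `N × N` block do not wrap around, and there the convolution
  -- equals `V^i W^j y`, of norm `‖y‖`. The ratio `(N + d) / N` tends to one.
  have key : ∀ N : ℕ, (N : ℝ) * ‖y‖ ≤ (N + d) * (polydiskNorm p * ‖x‖) := by
    intro N
    rcases Nat.eq_zero_or_pos N with rfl | hN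
    · simp only [Nat.cast_zero, zero_mul, zero_add]
      have := polydiskNorm_nonneg p
      positivity
    have hNd : NeZero (N + d) := ⟨by omega⟩
    let X : ZMod (N + d) × ZMod (N + d) → K := fun a => V^[a.1.val] (W^[a.2.val] x)
    let e : Fin 2 → ZMod (N + d) × ZMod (N + d) := ![(1, 0), (0, 1)]
    let ι : Fin N × Fin N → ZMod (N + d) × ZMod (N + d) := fun i => ((i.1 : ℕ), (i.2 : ℕ))
    have h := sum_norm_sq_convolution_le e p X
    have hX : ∑ a, ‖X a‖ ^ 2 = ((N + d) * ‖x‖) ^ 2 := by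
      simp only [X, hpow, Finset.sum_const, Finset.card_univ, Fintype.card_prod, ZMod.card]
      rw [nsmul_eq_mul]
      push_cast
      ring
    have hval : ∀ i : ℕ, i < N → ∀ l : ℕ, l ≤ d → ((i : ZMod (N + d)) + l).val = i + l := by
      intro i hi l hl
      rw [← Nat.cast_add, ZMod.val_natCast_of_lt (by omega)]
    have hY : ∀ i : Fin N × Fin N, ‖∑ m ∈ p.support, coeff m p •
        X (ι i + ∑ j, m j • e j)‖ = ‖y‖ := by
      rintro ⟨i, j⟩
      rw [← hpow V i y, ← hpow W j (V^[i] y)]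
      congr 1
      have hlin : ∀ (U : K →ₗᵢ[ℂ] K) (l : ℕ) (z : K), U^[l] z = (U.toLinearMap ^ l) z :=
        fun U l z => by rw [Module.End.pow_apply]; rfl
      rw [hy, hlin V, hlin W, map_sum, map_sum]
      refine Finset.sum_congr rfl fun m hm => ?_
      rw [map_smul, map_smul, ← hlin, ← hlin]
      congr 1
      have h1 : ι (i, j) + ∑ l, m l • e l =
          ((i : ZMod (N + d)) + (m 0 : ℕ), (j : ZMod (N + d)) + (m 1 : ℕ)) := by
        simp [ι, e, Fin.sum_univ_two, Prod.ext_iff]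
      rw [h1]
      simp only [X]
      rw [hval i i.2 _ (hd m hm).1, hval j j.2 _ (hd m hm).2, Function.iterate_add_apply,
        Function.iterate_add_apply, hcomm (m 0) j, hcomm i j]
    have hinj : Function.Injective ι := by
      rintro ⟨i, j⟩ ⟨i', j'⟩ hij
      simp only [ι, Prod.mk.injEq] at hij
      have h0 : ∀ l l' : Fin N, ((l : ℕ) : ZMod (N + d)) = (l' : ℕ) → l = l' := fun l l' hl => by
        have := congrArg ZMod.val hl
        rw [ZMod.val_natCast_of_lt (by omega), ZMod.val_natCast_of_lt (by omega)] at this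
        exact Fin.ext this
      rw [h0 _ _ hij.1, h0 _ _ hij.2]
    have hle : ((N : ℝ) * ‖y‖) ^ 2 ≤ ((N + d) * (polydiskNorm p * ‖x‖)) ^ 2 := by
      calc ((N : ℝ) * ‖y‖) ^ 2 = ∑ i : Fin N × Fin N, ‖∑ m ∈ p.support, coeff m p •
          X (ι i + ∑ j, m j • e j)‖ ^ 2 := by
            simp only [hY, Finset.sum_const, Finset.card_univ, Fintype.card_prod, Fintype.card_fin]
            rw [nsmul_eq_mul]
            push_cast
            ring
        _ ≤ ∑ a, ‖∑ m ∈ p.support, coeff m p • X (a + ∑ j, m j • e j)‖ ^ 2 := by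
            rw [← Finset.sum_image (s := Finset.univ) (g := ι)
              (f := fun a => ‖∑ m ∈ p.support, coeff m p • X (a + ∑ j, m j • e j)‖ ^ 2)
              hinj.injOn]
            exact Finset.sum_le_univ_sum_of_nonneg fun a => by positivity
        _ ≤ _ := h
        _ = _ := by rw [hX]; ring
    refine le_of_sq_le_sq ?_ ?_
    · exact hle
    · have := polydiskNorm_nonneg p
      positivity
  refine le_of_forall_pos_le_add fun ε hε => ?_
  set c := polydiskNorm p * ‖x‖ with hc
  obtain ⟨N, hN⟩ := exists_nat_gt (d * c / ε)
  have hc0 : 0 ≤ c := mul_nonneg (polydiskNorm_nonneg p) (norm_nonneg x)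
  have hN0 : (0 : ℝ) < N := lt_of_le_of_lt (by positivity) hN
  rw [div_lt_iff₀ hε] at hN
  refine le_of_mul_le_mul_left ?_ hN0
  linarith [key N]

end CommutingIsometries

/-! ### Ando's inequality by commuting isometric dilations. -/

section Dilation

/-- Two linear maps with the same pointwise norms differ by a unitary. -/
theorem exists_linearIsometryEquiv_apply_eq {E F : Type*} [AddCommGroup E] [Module ℂ E]
    [NormedAddCommGroup F] [InnerProductSpace ℂ F] [FiniteDimensional ℂ F] (A B : E →ₗ[ℂ] F)
    (h : ∀ x, ‖A x‖ = ‖B x‖) : ∃ G : F ≃ₗᵢ[ℂ] F, ∀ x, G (A x) = B x := by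
  have hker : LinearMap.ker A ≤ LinearMap.ker B := fun x hx => by
    rw [LinearMap.mem_ker] at hx ⊢
    rw [← norm_eq_zero, ← h, hx, norm_zero]
  let f : LinearMap.range A →ₗ[ℂ] F :=
    (Submodule.liftQ _ B hker) ∘ₗ (A.quotKerEquivRange.symm : LinearMap.range A →ₗ[ℂ] _)
  have hf : ∀ x, f ⟨A x, LinearMap.mem_range_self A x⟩ = B x := fun x => by
    have : A.quotKerEquivRange.symm ⟨A x, LinearMap.mem_range_self A x⟩ =
        (LinearMap.ker A).mkQ x := by
      rw [LinearEquiv.symm_apply_eq]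
      rfl
    simp only [f, LinearMap.comp_apply, LinearEquiv.coe_coe, this]
    simp
  let f' : LinearMap.range A →ₗᵢ[ℂ] F := ⟨f, by
    rintro ⟨_, x, rfl⟩
    rw [hf, ← h]
    rfl⟩
  -- Finite dimension is essential: the ranges have orthogonal complements of equal dimension, so
  -- the isometry between them extends to a unitary.
  refine ⟨f'.extend.toLinearIsometryEquiv rfl, fun x => ?_⟩
  rw [LinearIsometry.toLinearIsometryEquiv_apply]
  exact (LinearIsometry.extend_apply f' ⟨A x, LinearMap.mem_range_self A x⟩).trans (hf x)

/-- The defect operator of a contraction. -/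
theorem exists_defect {E : Type*} [NormedAddCommGroup E] [InnerProductSpace ℂ E]
    [CompleteSpace E] (S : E →L[ℂ] E) (hS : ∀ x, ‖S x‖ ≤ ‖x‖) :
    ∃ D : E →ₗ[ℂ] E, ∀ x, ‖S x‖ ^ 2 + ‖D x‖ ^ 2 = ‖x‖ ^ 2 := by
  -- The defect operator is the square root of `1 - S* S`.
  set P : E →L[ℂ] E := 1 - ContinuousLinearMap.adjoint S * S with hPdef
  have hP : ∀ x, inner ℂ (P x) x = ((‖x‖ ^ 2 - ‖S x‖ ^ 2 : ℝ) : ℂ) := fun x => by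
    rw [hPdef, sub_apply, inner_sub_left, mul_apply_eq_comp,
      ContinuousLinearMap.adjoint_inner_left, one_apply_eq_self,
      inner_self_eq_norm_sq_to_K, inner_self_eq_norm_sq_to_K]
    push_cast
    rfl
  have hP0 : 0 ≤ P := by
    rw [ContinuousLinearMap.nonneg_iff_isPositive, ContinuousLinearMap.isPositive_iff_complex]
    intro x
    rw [hP]
    refine ⟨rfl, ?_⟩
    have := hS x
    simp only [RCLike.re_to_complex, Complex.ofReal_re]
    nlinarith [norm_nonneg (S x), norm_nonneg x]
  refine ⟨(CFC.sqrt P : E →L[ℂ] E), fun x => ?_⟩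
  have hsa : IsSelfAdjoint (CFC.sqrt P) := (CFC.sqrt_nonneg P).isSelfAdjoint
  have h1 : ((‖CFC.sqrt P x‖ ^ 2 : ℝ) : ℂ) = ((‖x‖ ^ 2 - ‖S x‖ ^ 2 : ℝ) : ℂ) := by
    rw [← hP]
    conv_rhs => rw [← CFC.sqrt_mul_sqrt_self P hP0, mul_apply_eq_comp]
    rw [← ContinuousLinearMap.adjoint_inner_right, hsa.adjoint_eq, inner_self_eq_norm_sq_to_K]
    push_cast
    rfl
  have h2 := Complex.ofReal_injective h1
  simp only [ContinuousLinearMap.coe_coe]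
  linarith

theorem lp.hasSum_norm_sq {F : Type*} [NormedAddCommGroup F] (y : lp (fun _ : ℕ => F) 2) :
    HasSum (fun n => ‖y n‖ ^ 2) (‖y‖ ^ 2) := by
  have := lp.hasSum_norm (p := 2) (by norm_num) y
  simpa using this

/-- The same nonnegative terms are bracketed differently, with `d` added in front. -/
theorem hasSum_of_half_shift {a b f : ℕ → ℝ} {c d : ℝ} (ha : ∀ n, 0 ≤ a n) (hb : ∀ n, 0 ≤ b n)
    (h : HasSum (fun n => a n + b n) c) (h0 : f 0 = d + a 0)
    (hf : ∀ n, f (n + 1) = b n + a (n + 1)) : HasSum f (d + c) := by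
  obtain ⟨A, hA⟩ : Summable a := Summable.of_nonneg_of_le ha
    (fun n => le_add_of_nonneg_right (hb n)) h.summable
  obtain ⟨B, hB⟩ : Summable b := Summable.of_nonneg_of_le hb
    (fun n => le_add_of_nonneg_left (ha n)) h.summable
  have hc : c = A + B := h.unique (hA.add hB)
  have hA' : HasSum (fun n => a (n + 1)) (A - a 0) := by
    simpa using (hasSum_nat_add_iff' 1).2 hA
  have hsucc : HasSum (fun n => f (n + 1)) (B + (A - a 0)) := by
    simp only [hf]
    exact hB.add hA'
  have := (hasSum_nat_add_iff 1).1 hsucc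
  rw [Finset.sum_range_one, h0] at this
  rwa [hc, show d + (A + B) = B + (A - a 0) + (d + a 0) by ring]

/-- The element of `ℓ²` with given square summable entries. -/
def lp.ofSummableSq {F : Type*} [NormedAddCommGroup F] (y : ℕ → F)
    (h : Summable fun n => ‖y n‖ ^ 2) : lp (fun _ : ℕ => F) 2 :=
  ⟨y, memℓp_gen (by simpa using h)⟩

theorem lp.norm_sq_ofSummableSq {F : Type*} [NormedAddCommGroup F] (y : ℕ → F)
    (h : Summable fun n => ‖y n‖ ^ 2) {c : ℝ} (hc : HasSum (fun n => ‖y n‖ ^ 2) c) :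
    ‖lp.ofSummableSq y h‖ ^ 2 = c :=
  (lp.hasSum_norm_sq (lp.ofSummableSq y h)).unique hc

variable {E : Type*} [NormedAddCommGroup E]

/-- Shift a sequence of pairs by half a block, inserting `d` in front. -/
def halfShift (d : E) (y : ℕ → WithLp 2 (E × E)) : ℕ → WithLp 2 (E × E)
  | 0 => WithLp.toLp 2 (d, (y 0).fst)
  | n + 1 => WithLp.toLp 2 ((y n).snd, (y (n + 1)).fst)

theorem hasSum_norm_sq_halfShift (d : E) {y : ℕ → WithLp 2 (E × E)} {c : ℝ}
    (h : HasSum (fun n => ‖y n‖ ^ 2) c) :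
    HasSum (fun n => ‖halfShift d y n‖ ^ 2) (‖d‖ ^ 2 + c) := by
  have h' : HasSum (fun n => ‖(y n).fst‖ ^ 2 + ‖(y n).snd‖ ^ 2) c := by
    simpa only [WithLp.prod_norm_sq_eq_of_L2] using h
  exact hasSum_of_half_shift (fun _ => sq_nonneg _) (fun _ => sq_nonneg _) h'
    (WithLp.prod_norm_sq_eq_of_L2 _) fun n => WithLp.prod_norm_sq_eq_of_L2 _

/-- The dilation space `E ⊕ ℓ²(E ⊕ E)`. -/
abbrev DilationSpace (E : Type*) [NormedAddCommGroup E] :=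
  WithLp 2 (E × lp (fun _ : ℕ => WithLp 2 (E × E)) 2)

theorem DilationSpace.ext {x y : DilationSpace E} (h1 : x.fst = y.fst)
    (h2 : ∀ n, x.snd n = y.snd n) : x = y := by
  apply (WithLp.ofLp_injective 2)
  exact Prod.ext h1 (lp.ext (funext h2))

theorem halfShift_add (d e : E) (y z : ℕ → WithLp 2 (E × E)) (n : ℕ) :
    halfShift (d + e) (fun n => y n + z n) n = halfShift d y n + halfShift e z n := by
  cases n <;> rfl

variable [InnerProductSpace ℂ E]

theorem halfShift_smul (c : ℂ) (d : E) (y : ℕ → WithLp 2 (E × E)) (n : ℕ) :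
    halfShift (c • d) (fun n => c • y n) n = c • halfShift d y n := by
  cases n <;> rfl

/-- The isometric dilation of a contraction `S` with defect operator `D`. -/
noncomputable def isometricDilation (S D : E →ₗ[ℂ] E)
    (h : ∀ x, ‖S x‖ ^ 2 + ‖D x‖ ^ 2 = ‖x‖ ^ 2) : DilationSpace E →ₗᵢ[ℂ] DilationSpace E where
  toFun x := WithLp.toLp 2 (S x.fst, lp.ofSummableSq (halfShift (D x.fst) fun n => x.snd n)
    (hasSum_norm_sq_halfShift _ (lp.hasSum_norm_sq x.snd)).summable)
  map_add' x y := by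
    refine DilationSpace.ext (map_add S _ _) fun n => ?_
    refine Eq.trans ?_ (halfShift_add (D x.fst) (D y.fst) (fun n => x.snd n)
      (fun n => y.snd n) n)
    rw [← map_add]
    rfl
  map_smul' c x := by
    refine DilationSpace.ext (map_smul S _ _) fun n => ?_
    refine Eq.trans ?_ (halfShift_smul c (D x.fst) (fun n => x.snd n) n)
    rw [← map_smul]
    rfl
  norm_map' x := by
    rw [← sq_eq_sq₀ (norm_nonneg _) (norm_nonneg _), WithLp.prod_norm_sq_eq_of_L2,
      WithLp.prod_norm_sq_eq_of_L2 x, ← h x.fst, add_assoc]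
    refine congrArg (‖S x.fst‖ ^ 2 + ·) ?_
    have hs := hasSum_norm_sq_halfShift (D x.fst) (lp.hasSum_norm_sq x.snd)
    exact lp.norm_sq_ofSummableSq _ hs.summable hs

/-- Apply an isometry of `E ⊕ E` in every block. -/
noncomputable def blockIsometry (G : WithLp 2 (E × E) →ₗᵢ[ℂ] WithLp 2 (E × E)) :
    DilationSpace E →ₗᵢ[ℂ] DilationSpace E where
  toFun x := WithLp.toLp 2 (x.fst, lp.ofSummableSq (fun n => G (x.snd n)) (by
    simpa using (lp.hasSum_norm_sq x.snd).summable))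
  map_add' x y := DilationSpace.ext rfl fun n => map_add G (x.snd n) (y.snd n)
  map_smul' c x := DilationSpace.ext rfl fun n => map_smul G c (x.snd n)
  norm_map' x := by
    rw [← sq_eq_sq₀ (norm_nonneg _) (norm_nonneg _), WithLp.prod_norm_sq_eq_of_L2,
      WithLp.prod_norm_sq_eq_of_L2 x]
    congr 1
    refine lp.norm_sq_ofSummableSq (fun n => G (x.snd n)) (by
      simpa using (lp.hasSum_norm_sq x.snd).summable) ?_
    simpa using lp.hasSum_norm_sq x.snd

/-- **Ando's inequality** on a finite-dimensional space. -/
theorem norm_sum_contraction_le [FiniteDimensional ℂ E] (S T : E →ₗ[ℂ] E)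
    (hS : ∀ x, ‖S x‖ ≤ ‖x‖) (hT : ∀ x, ‖T x‖ ≤ ‖x‖) (hST : ∀ x, S (T x) = T (S x))
    (p : MvPolynomial (Fin 2) ℂ) (x : E) :
    ‖∑ m ∈ p.support, coeff m p • S^[m 0] (T^[m 1] x)‖ ≤ polydiskNorm p * ‖x‖ := by
  have := FiniteDimensional.complete ℂ E
  obtain ⟨DS, hDS⟩ := exists_defect (LinearMap.toContinuousLinearMap S) hS
  obtain ⟨DT, hDT⟩ := exists_defect (LinearMap.toContinuousLinearMap T) hT
  simp only [LinearMap.coe_toContinuousLinearMap'] at hDS hDT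
  have hfd : FiniteDimensional ℂ (WithLp 2 (E × E)) :=
    (WithLp.linearEquiv 2 ℂ (E × E)).symm.finiteDimensional
  -- Both sides have squared norm `‖z‖² - ‖S (T z)‖²`, by telescoping the defect identities and
  -- using commutativity.
  obtain ⟨G, hG⟩ := exists_linearIsometryEquiv_apply_eq
    ((WithLp.linearEquiv 2 ℂ (E × E)).symm.toLinearMap ∘ₗ (DS ∘ₗ T).prod DT)
    ((WithLp.linearEquiv 2 ℂ (E × E)).symm.toLinearMap ∘ₗ (DT ∘ₗ S).prod DS) (fun z => by
      rw [← sq_eq_sq₀ (norm_nonneg _) (norm_nonneg _), WithLp.prod_norm_sq_eq_of_L2,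
        WithLp.prod_norm_sq_eq_of_L2]
      change ‖DS (T z)‖ ^ 2 + ‖DT z‖ ^ 2 = ‖DT (S z)‖ ^ 2 + ‖DS z‖ ^ 2
      have h1 := hDS (T z)
      have h2 := hDT (S z)
      rw [hST] at h1
      linarith [hDS z, hDT z])
  replace hG : ∀ z, G (WithLp.toLp 2 (DS (T z), DT z)) = WithLp.toLp 2 (DT (S z), DS z) := hG
  -- Two half shifts make one full block shift, which commutes with `G` in every block. So `V W` and
  -- `W V` both move the old blocks by one unchanged, and the inserted first blocks agree by the
  -- choice of `G`.
  let V := (blockIsometry G.toLinearIsometry).comp (isometricDilation S DS hDS)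
  let W := (isometricDilation T DT hDT).comp (blockIsometry G.symm.toLinearIsometry)
  have hVW : ∀ z, V (W z) = W (V z) := by
    intro z
    have hVs : ∀ z n, (V z).snd n = G (halfShift (DS z.fst) (fun n => z.snd n) n) :=
      fun _ _ => rfl
    have hWs : ∀ z n, (W z).snd n = halfShift (DT z.fst) (fun n => G.symm (z.snd n)) n :=
      fun _ _ => rfl
    have hVf : (V z).fst = S z.fst := rfl
    have hWf : (W z).fst = T z.fst := rfl
    refine DilationSpace.ext (hST z.fst) fun n => ?_
    rw [hVs, hWs]
    simp only [hVs, hWs, hVf, hWf, LinearIsometryEquiv.symm_apply_apply]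
    rcases n with _ | _ | n
    · exact hG z.fst
    · exact G.apply_symm_apply _
    · exact G.apply_symm_apply _
  have hV : ∀ i z, (V^[i] z).fst = S^[i] z.fst := fun i z => by
    induction i generalizing z with
    | zero => rfl
    | succ i ih => rw [Function.iterate_succ_apply, ih]; rfl
  have hW : ∀ i z, (W^[i] z).fst = T^[i] z.fst := fun i z => by
    induction i generalizing z with
    | zero => rfl
    | succ i ih => rw [Function.iterate_succ_apply, ih]; rfl
  let x' : DilationSpace E := WithLp.toLp 2 (x, 0)
  have hx' : ‖x'‖ = ‖x‖ := by
    rw [← sq_eq_sq₀ (norm_nonneg _) (norm_nonneg _), WithLp.prod_norm_sq_eq_of_L2]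
    simp [x']
  have hfst : ∑ m ∈ p.support, coeff m p • S^[m 0] (T^[m 1] x) =
      (∑ m ∈ p.support, coeff m p • V^[m 0] (W^[m 1] x')).fst := by
    have : ∀ z : DilationSpace E, z.fst = (LinearMap.fst ℂ _ _ ∘ₗ
      (WithLp.linearEquiv 2 ℂ (E × lp (fun _ : ℕ => WithLp 2 (E × E)) 2)).toLinearMap) z :=
      fun z => rfl
    rw [this, map_sum]
    refine Finset.sum_congr rfl fun m _ => ?_
    rw [map_smul, ← this, hV, hW]
    rfl
  have hle : ∀ z : DilationSpace E, ‖z.fst‖ ≤ ‖z‖ := fun z => by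
    rw [← sq_le_sq₀ (norm_nonneg _) (norm_nonneg _), WithLp.prod_norm_sq_eq_of_L2 z]
    nlinarith [sq_nonneg ‖z.snd‖]
  rw [hfst, ← hx']
  exact (hle _).trans (norm_sum_isometry_le V W hVW p x')

end Dilation

/-- **Ando's inequality** for a representation of `ℂᵏ`. -/
theorem HasHilbertRepresentation.aeval_le {k : ℕ} {N : AlgebraNorm ℂ (Fin k → ℂ)}
    (hN : HasHilbertRepresentation N) {a b : Fin k → ℂ} (ha : N a ≤ 1) (hb : N b ≤ 1)
    (p : MvPolynomial (Fin 2) ℂ) : N (aeval ![a, b] p) ≤ polydiskNorm p := by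
  obtain ⟨H, _, _, _, π, hπ⟩ := hN
  rw [← hπ]
  refine ContinuousLinearMap.opNorm_le_bound _ (polydiskNorm_nonneg p) fun x => ?_
  -- The range of `ev` is the cyclic subspace of `x`: invariant and of dimension at most `k`, so the
  -- finite-dimensional inequality applies on it.
  let ev : (Fin k → ℂ) →ₗ[ℂ] H :=
    { toFun := fun w => π w x
      map_add' := fun u v => by simp
      map_smul' := fun c u => by simp }
  let R := LinearMap.range ev
  have hR : ∀ w, ∀ y ∈ R, (π w : H →ₗ[ℂ] H) y ∈ R := by
    rintro w _ ⟨u, rfl⟩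
    exact ⟨w * u, by simp [ev]⟩
  let S : R →ₗ[ℂ] R := (π a : H →ₗ[ℂ] H).restrict (hR a)
  let T : R →ₗ[ℂ] R := (π b : H →ₗ[ℂ] H).restrict (hR b)
  have hx : x ∈ R := ⟨1, by simp [ev]⟩
  have hcon : ∀ w, N w ≤ 1 → ∀ y, ‖π w y‖ ≤ ‖y‖ := fun w hw y => by
    refine ((π w).le_opNorm y).trans ?_
    rw [hπ]
    exact mul_le_of_le_one_left (norm_nonneg y) hw
  have h := norm_sum_contraction_le S T (fun y => hcon a ha y) (fun y => hcon b hb y)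
    (fun y => Subtype.ext (by
      change π a (π b y) = π b (π a y)
      rw [← mul_apply_eq_comp, ← mul_apply_eq_comp, ← map_mul,
        ← map_mul, mul_comm])) p ⟨x, hx⟩
  have hS : ∀ i y, ((S^[i] y : R) : H) = π (a ^ i) y := fun i y => by
    induction i generalizing y with
    | zero => simp
    | succ i ih =>
      rw [Function.iterate_succ_apply, ih, pow_succ, map_mul, mul_apply_eq_comp]
      rfl
  have hT : ∀ i y, ((T^[i] y : R) : H) = π (b ^ i) y := fun i y => by
    induction i generalizing y with
    | zero => simp
    | succ i ih =>
      rw [Function.iterate_succ_apply, ih, pow_succ, map_mul, mul_apply_eq_comp]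
      rfl
  have heq : π (aeval ![a, b] p) x =
      ((∑ m ∈ p.support, coeff m p • S^[m 0] (T^[m 1] ⟨x, hx⟩) : R) : H) := by
    rw [aeval_def, eval₂_eq', Submodule.coe_sum, map_sum, sum_apply]
    refine Finset.sum_congr rfl fun m _ => ?_
    rw [Submodule.coe_smul, hS, hT, ← Algebra.smul_def, map_smul, Fin.prod_univ_two, map_mul]
    rfl
  rw [heq]
  exact h

/-! ### The hyperconvex hull of a pair lies in its operator algebra hull. -/

/-- A set of at most two points may be replaced by an ordered pair when testing containment in
unit balls of algebra norms. -/
theorem exists_pair_of_encard_le_two {k : ℕ} {D : Set (Fin k → ℂ)} (hD : D ⊆ closedPolydisk k)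
    (hcard : D.encard ≤ 2) : ∃ a b, a ∈ closedPolydisk k ∧ b ∈ closedPolydisk k ∧
      ∀ N : AlgebraNorm ℂ (Fin k → ℂ), D ⊆ algebraBall N ↔ N a ≤ 1 ∧ N b ≤ 1 := by
  have h : D = ∅ ∨ ∃ a b, D = {a, b} := by
    rcases D.eq_empty_or_nonempty with h | ⟨a, ha⟩
    · exact Or.inl h
    · right
      by_cases hb : ∃ b ∈ D, b ≠ a
      · obtain ⟨b, hb, hba⟩ := hb
        refine ⟨a, b, (Set.Finite.eq_of_subset_of_encard_le ?_ ?_ ?_).symm⟩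
        · exact Set.toFinite _
        · rintro x (rfl | rfl)
          exacts [ha, hb]
        · rwa [Set.encard_pair hba.symm]
      · push Not at hb
        refine ⟨a, a, ?_⟩
        ext x
        constructor
        · intro hx
          simp [hb x hx]
        · intro hx
          have : x = a := by simpa using hx
          rwa [this]
  rcases h with rfl | ⟨a, b, rfl⟩
  -- The empty set is replaced by the origin, which lies in every ball.
  · exact ⟨0, 0, zero_mem_closedPolydisk k, zero_mem_closedPolydisk k, fun N => by simp⟩
  · exact ⟨a, b, hD (by simp), hD (by simp), fun N => by
      simp [Set.insert_subset_iff, algebraBall]⟩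

/-- The pair `a, b` together with the standard idempotents scaled by `r`. -/
noncomputable def extendedTuple {k : ℕ} (a b : Fin k → ℂ) (r : ℝ) : Fin (k + 2) → Fin k → ℂ :=
  Fin.cons a (Fin.cons b fun i => Pi.single i (r : ℂ))

theorem extendedTuple_mem {k : ℕ} {a b : Fin k → ℂ} (ha : a ∈ closedPolydisk k)
    (hb : b ∈ closedPolydisk k) {r : ℝ} (hr : |r| ≤ 1) (j : Fin (k + 2)) :
    extendedTuple a b r j ∈ closedPolydisk k := by
  refine Fin.cases ha (fun j => Fin.cases hb (fun i => ?_) j) j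
  intro l
  simp only [extendedTuple, Fin.cons_succ, Pi.single_apply]
  split_ifs
  · simpa using hr
  · simp

/-- The pair alone may fail to separate the coordinates; the scaled idempotents span `ℂᵏ`. -/
theorem aeval_extendedTuple_surjective {k : ℕ} (a b : Fin k → ℂ) {r : ℝ} (hr : r ≠ 0) :
    Function.Surjective
      (aeval (extendedTuple a b r) : MvPolynomial (Fin (k + 2)) ℂ →ₐ[ℂ] (Fin k → ℂ)) := by
  intro w
  refine ⟨∑ i, (w i / r) • X i.succ.succ, ?_⟩
  have hr' : (r : ℂ) ≠ 0 := by exact_mod_cast hr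
  ext l
  simp only [map_sum, map_smul, aeval_X, extendedTuple, Fin.cons_succ, Finset.sum_apply,
    Pi.smul_apply, Pi.single_apply, smul_eq_mul, mul_ite, mul_zero, Finset.sum_ite_eq,
    Finset.mem_univ, if_true, div_mul_cancel₀ _ hr']

/-- A Schwarz estimate for polynomials on the polydisk. -/
theorem norm_eval_sub_eval_le {n : ℕ} (p : MvPolynomial (Fin n) ℂ) (z u : Fin n → ℂ)
    (h : ∀ t : ℂ, ‖t‖ ≤ 1 → z + t • u ∈ closedPolydisk n) {r : ℝ} (hr : r ∈ Set.Ioo (0 : ℝ) 1)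
    {c : ℝ} (hc : polydiskNorm p < c) :
    ‖eval (z + (r : ℂ) • u) p - eval z p‖ ≤ 2 * c * r := by
  let f : ℂ → ℂ := fun t => eval (z + t • u) p
  have hf : Differentiable ℂ f := by
    intro t
    have h1 : f = fun t => ∑ m ∈ p.support, coeff m p * ∏ i, (z i + t * u i) ^ m i := by
      funext t
      simp [f, eval_eq']
    rw [h1]
    fun_prop
  have hfle : ∀ t : ℂ, ‖t‖ ≤ 1 → ‖f t‖ < c := fun t ht =>
    (norm_eval_le_polydiskNorm p (h t ht)).trans_lt hc
  -- On the disk `f` stays within `2 * c` of `f 0`, which is the hypothesis of the Schwarz lemma.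
  have hmaps : Set.MapsTo f (Metric.ball 0 1) (Metric.closedBall (f 0) (2 * c)) := by
    intro t ht
    rw [mem_ball_zero_iff] at ht
    rw [mem_closedBall_iff_norm]
    have := norm_sub_le (f t) (f 0)
    linarith [hfle t ht.le, hfle 0 (by simp)]
  have hrball : (r : ℂ) ∈ Metric.ball (0 : ℂ) 1 := by
    rw [mem_ball_zero_iff, Complex.norm_real, Real.norm_of_nonneg hr.1.le]
    exact hr.2
  have := Complex.dist_le_div_mul_dist_of_mapsTo_ball hf.differentiableOn hmaps hrball
  rw [dist_eq_norm, dist_zero_right, Complex.norm_real, Real.norm_of_nonneg hr.1.le, div_one] at this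
  simpa [f] using this

/-- The quotient norm of `extendedTuple a b r` is an admissible `M` for every small `r`. The bound
`1 + r` comes from a near-optimal lift of `v`, the term with `C` from discarding the idempotents. -/
theorem hyperconvexBallGen_subset {k : ℕ} {a b : Fin k → ℂ} (ha : a ∈ closedPolydisk k)
    (hb : b ∈ closedPolydisk k) {N : AlgebraNorm ℂ (Fin k → ℂ)} (hN1 : N 1 = 1)
    (hN : HasHilbertRepresentation N) (hNa : N a ≤ 1) (hNb : N b ≤ 1) {v : Fin k → ℂ}
    (hv : ∀ M : AlgebraNorm ℂ (Fin k → ℂ), M 1 = 1 → SatisfiesMultivariableVonNeumann M →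
      M a ≤ 1 → M b ≤ 1 → M v ≤ 1) : N v ≤ 1 := by
  have hk : NeZero k := ⟨by
    rintro rfl
    rw [Subsingleton.elim (1 : Fin 0 → ℂ) 0, map_zero] at hN1
    exact zero_ne_one hN1⟩
  set C := ∑ i, N (Pi.single i 1) with hC
  have key : ∀ r ∈ Set.Ioo (0 : ℝ) 1, N v ≤ 1 + r + C * (2 * (1 + r) * r) := by
    intro r hr
    have hg := extendedTuple_mem ha hb (r := r) (abs_le.2 ⟨by linarith [hr.1], hr.2.le⟩)
    have hs := aeval_extendedTuple_surjective a b hr.1.ne'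
    have hM := hv (quotientAlgebraNorm hg hs) (quotientNorm_one hg hs)
      (satisfiesMultivariableVonNeumann_quotientAlgebraNorm hg hs)
      (quotientNorm_generator_le _ 0) (quotientNorm_generator_le _ 1)
    rw [quotientAlgebraNorm_apply] at hM
    obtain ⟨p, rfl, hp⟩ := exists_of_quotientNorm_lt hs
      (hM.trans_lt (lt_add_of_pos_right 1 hr.1))
    -- Zero is substituted for the extra variables, leaving a polynomial in two variables for Ando's
    -- inequality.
    let P : Fin (k + 2) → MvPolynomial (Fin 2) ℂ := Fin.cons (X 0) (Fin.cons (X 1) fun _ => 0)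
    have hP : ∀ j, polydiskNorm (P j) ≤ 1 := fun j => by
      refine Fin.cases ?_ (fun j => Fin.cases ?_ (fun i => ?_) j) j
      · exact polydiskNorm_le fun z hz => by simpa [P] using hz 0
      · exact polydiskNorm_le fun z hz => by simpa [P] using hz 1
      · exact polydiskNorm_le fun z hz => by simp [P]
    set v' := aeval ![a, b] (aeval P p) with hv'
    have h1 : N v' ≤ 1 + r :=
      (hN.aeval_le hNa hNb _).trans ((polydiskNorm_aeval_le p P hP).trans hp.le)
    have h2 : ∀ i, ‖(aeval (extendedTuple a b r) p - v') i‖ ≤ 2 * (1 + r) * r := by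
      intro i
      have hvi : v' = aeval (extendedTuple a b 0) p := by
        rw [hv', ← AlgHom.comp_apply, comp_aeval]
        congr 2
        funext j
        refine Fin.cases ?_ (fun j => Fin.cases ?_ (fun l => ?_) j) j <;>
          simp [P, extendedTuple]
      rw [hvi, Pi.sub_apply, aeval_pi_apply, aeval_pi_apply]
      have hex : ∀ t : ℝ, (fun j => extendedTuple a b t j i) =
          (fun j => extendedTuple a b 0 j i) + (t : ℂ) •
            (Fin.cons 0 (Fin.cons 0 fun l => (Pi.single l 1 : Fin k → ℂ) i) :
              Fin (k + 2) → ℂ) := fun t => by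
        funext j
        refine Fin.cases ?_ (fun j => Fin.cases ?_ (fun l => ?_) j) j <;>
          simp [extendedTuple, Pi.single_apply]
      rw [hex r]
      refine norm_eval_sub_eval_le p _ _ (fun t ht => ?_) hr hp
      intro j
      refine Fin.cases ?_ (fun j => Fin.cases ?_ (fun l => ?_) j) j
      · simpa [extendedTuple] using ha i
      · simpa [extendedTuple] using hb i
      · simp only [Pi.add_apply, Pi.smul_apply, extendedTuple, Fin.cons_succ, Complex.ofReal_zero,
          Pi.single_zero, Pi.zero_apply, zero_add, smul_eq_mul, Pi.single_apply]
        split_ifs <;> simp [ht]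
    calc N (aeval (extendedTuple a b r) p)
        = N (v' + (aeval (extendedTuple a b r) p - v')) := by congr 1; abel
      _ ≤ _ := (map_add_le_add N _ _).trans (add_le_add h1 (N.le_mul_sup _ h2))
  have hcont : Filter.Tendsto (fun r : ℝ => 1 + r + C * (2 * (1 + r) * r))
      (nhdsWithin 0 (Set.Ioi 0)) (nhds 1) := by
    have : Continuous fun r : ℝ => 1 + r + C * (2 * (1 + r) * r) := by fun_prop
    exact (this.tendsto' 0 _ (by simp)).mono_left nhdsWithin_le_nhds
  refine ge_of_tendsto hcont ?_
  filter_upwards [Ioo_mem_nhdsGT (show (0 : ℝ) < 1 by norm_num)] with r hr using key r hr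

/-! ### Dominating a functional by a state on the polydisk. -/

section State

variable {n : ℕ}

/-- The function `|p|²` on the closed polydisk. -/
noncomputable def polydiskNormSq (p : MvPolynomial (Fin n) ℂ) : C(closedPolydisk n, ℝ) :=
  ⟨fun z => ‖eval z.1 p‖ ^ 2, by
    have := (MvPolynomial.continuous_eval p).comp
      (continuous_subtype_val (p := fun z => z ∈ closedPolydisk n))
    exact this.norm.pow 2⟩

theorem polydiskNormSq_apply (p : MvPolynomial (Fin n) ℂ) (z : closedPolydisk n) :
    polydiskNormSq p z = ‖eval z.1 p‖ ^ 2 := rfl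

/-- A linear functional dominated by the supremum norm is dominated by the `L²` norm of a
state. -/
theorem exists_state_norm_sq_le (ψ : MvPolynomial (Fin n) ℂ →ₗ[ℂ] ℂ)
    (hψ : ∀ p, ‖ψ p‖ ≤ polydiskNorm p) :
    ∃ m : C(closedPolydisk n, ℝ) →ₗ[ℝ] ℝ, (∀ u, 0 ≤ u → 0 ≤ m u) ∧ m 1 = 1 ∧
      ∀ p, ‖ψ p‖ ^ 2 ≤ m (polydiskNormSq p) := by
  have : CompactSpace (closedPolydisk n) := isCompact_iff_compactSpace.1 (isCompact_closedPolydisk n)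
  let U : Set C(closedPolydisk n, ℝ) := {u | ∀ z, 0 < u z}
  -- The goal is linearised as `2 Re ψ(p) - 1 ≤ m(|p|²)` for all `p`. Convexity of `p ↦ |p|²` makes
  -- `A` convex, and a functional separating it from the positive functions yields `m`.
  let A : Set C(closedPolydisk n, ℝ) :=
    {u | ∃ p, ∀ z : closedPolydisk n, u z ≤ 2 * (ψ p).re - 1 - ‖eval z.1 p‖ ^ 2}
  have hUo : IsOpen U := by
    have h := ContinuousMap.isOpen_setOfPred_mapsTo (X := closedPolydisk n) (Y := ℝ) isCompact_univ
      (isOpen_Ioi (a := (0 : ℝ)))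
    simpa [Set.MapsTo, U] using h
  have hUc : Convex ℝ U := by
    intro u hu v hv s t hs ht hst z
    simp only [ContinuousMap.add_apply, ContinuousMap.smul_apply, smul_eq_mul]
    rcases hs.eq_or_lt with rfl | hs
    · have ht1 : t = 1 := by linarith
      simpa [ht1] using hv z
    · have := mul_pos hs (hu z)
      have := mul_nonneg ht (hv z).le
      linarith
  have hAc : Convex ℝ A := by
    rintro u ⟨p, hp⟩ v ⟨q, hq⟩ s t hs ht hst
    refine ⟨(s : ℂ) • p + (t : ℂ) • q, fun z => ?_⟩
    have h1 : ‖eval z.1 ((s : ℂ) • p + (t : ℂ) • q)‖ ≤ s * ‖eval z.1 p‖ + t * ‖eval z.1 q‖ := by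
      rw [map_add, smul_eval, smul_eval]
      refine (norm_add_le _ _).trans_eq ?_
      rw [norm_mul, norm_mul, Complex.norm_real, Complex.norm_real, Real.norm_of_nonneg hs,
        Real.norm_of_nonneg ht]
    have h2 : ‖eval z.1 ((s : ℂ) • p + (t : ℂ) • q)‖ ^ 2 ≤
        s * ‖eval z.1 p‖ ^ 2 + t * ‖eval z.1 q‖ ^ 2 := by
      refine (pow_le_pow_left₀ (norm_nonneg _) h1 2).trans ?_
      have ht' : t = 1 - s := by linarith
      subst ht'
      nlinarith [mul_nonneg (mul_nonneg hs ht) (sq_nonneg (‖eval z.1 p‖ - ‖eval z.1 q‖))]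
    have h3 : (ψ ((s : ℂ) • p + (t : ℂ) • q)).re = s * (ψ p).re + t * (ψ q).re := by
      simp
    rw [h3]
    simp only [ContinuousMap.add_apply, ContinuousMap.smul_apply, smul_eq_mul]
    have h4 := mul_le_mul_of_nonneg_left (hp z) hs
    have h5 := mul_le_mul_of_nonneg_left (hq z) ht
    have h6 : (1 : ℝ) = s + t := hst.symm
    nlinarith
  have hdisj : Disjoint U A := by
    rw [Set.disjoint_left]
    rintro u hu ⟨p, hp⟩
    have h1 : ∀ z ∈ closedPolydisk n, ‖eval z p‖ ^ 2 ≤ 2 * (ψ p).re - 1 := fun z hz => by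
      have := hp ⟨z, hz⟩
      have := hu ⟨z, hz⟩
      simp only at *
      linarith
    have h0 : 0 ≤ 2 * (ψ p).re - 1 := (sq_nonneg _).trans (h1 0 (zero_mem_closedPolydisk n))
    -- The maximum `c` of `|p|²` is attained, hence strictly below `2 Re ψ(p) - 1 ≤ 2√c - 1 ≤ c`, a
    -- contradiction.
    have hlt : ∃ c < 2 * (ψ p).re - 1, 0 ≤ c ∧ ∀ z ∈ closedPolydisk n, ‖eval z p‖ ^ 2 ≤ c := by
      have hne : (closedPolydisk n).Nonempty := ⟨0, zero_mem_closedPolydisk n⟩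
      obtain ⟨z, hz, hmax⟩ := (isCompact_closedPolydisk n).exists_isMaxOn hne
        ((MvPolynomial.continuous_eval p).norm.pow 2).continuousOn
      refine ⟨‖eval z p‖ ^ 2, ?_, sq_nonneg _, fun y hy => hmax hy⟩
      have := hp ⟨z, hz⟩
      have := hu ⟨z, hz⟩
      simp only at *
      linarith
    obtain ⟨c, hc, hc0, hcz⟩ := hlt
    have h2 : polydiskNorm p ≤ √c := polydiskNorm_le fun z hz => Real.le_sqrt_of_sq_le (hcz z hz)
    have h3 : (ψ p).re ≤ √c := ((Complex.re_le_norm _).trans (hψ p)).trans h2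
    nlinarith [Real.sq_sqrt hc0, sq_nonneg (√c - 1)]
  obtain ⟨f, s, hf1, hf2⟩ := geometric_hahn_banach_open hUc hUo hAc hdisj
  have hU1 : ∀ c : ℝ, 0 < c → c • (1 : C(closedPolydisk n, ℝ)) ∈ U := fun c hc z => by simpa using hc
  have hs0 : 0 ≤ s := by
    by_contra! hs
    have hlim : Filter.Tendsto (fun t : ℝ => t * f 1) (nhdsWithin 0 (Set.Ioi 0)) (nhds 0) := by
      have : Continuous fun t : ℝ => t * f 1 := by fun_prop
      exact (this.tendsto' 0 _ (by simp)).mono_left nhdsWithin_le_nhds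
    have h : (0 : ℝ) ≤ s := by
      refine le_of_tendsto hlim ?_
      filter_upwards [self_mem_nhdsWithin] with t ht
      have := hf1 _ (hU1 t ht)
      rw [map_smul, smul_eq_mul] at this
      exact this.le
    linarith
  have hU : ∀ u ∈ U, f u ≤ 0 := by
    intro u hu
    by_contra! h
    have hmem : ((s + 1) / f u) • u ∈ U := fun z => by
      have := hu z
      simp only [ContinuousMap.smul_apply, smul_eq_mul]
      positivity
    have := hf1 _ hmem
    rw [map_smul, smul_eq_mul, div_mul_cancel₀ _ h.ne'] at this
    linarith
  have hf1' : f 1 < 0 := by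
    have h1 : f 1 < s := by simpa using hf1 _ (hU1 1 one_pos)
    have h2 : s ≤ f (-1) := hf2 _ ⟨0, fun z => by simp⟩
    rw [map_neg] at h2
    linarith
  have hpos : ∀ u : C(closedPolydisk n, ℝ), 0 ≤ u → f u ≤ 0 := by
    intro u hu
    refine le_of_forall_pos_le_add fun ε hε => ?_
    have hmem : u + (ε / -f 1) • (1 : C(closedPolydisk n, ℝ)) ∈ U := fun z => by
      have h1 : 0 ≤ u z := hu z
      have h2 : 0 < ε / -f 1 := div_pos hε (by linarith)
      simp only [ContinuousMap.add_apply, ContinuousMap.smul_apply, ContinuousMap.one_apply,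
        smul_eq_mul, mul_one]
      linarith
    have := hU _ hmem
    rw [map_add, map_smul, smul_eq_mul, div_neg, neg_mul, div_mul_cancel₀ _ hf1'.ne] at this
    linarith
  have hfA : ∀ p, f 1 * (2 * (ψ p).re - 1) ≥ f (polydiskNormSq p) := by
    intro p
    have h1 : (2 * (ψ p).re - 1) • (1 : C(closedPolydisk n, ℝ)) - polydiskNormSq p ∈ A :=
      ⟨p, fun z => by simp [polydiskNormSq_apply]⟩
    have := hf2 _ h1
    rw [map_sub, map_smul, smul_eq_mul] at this
    linarith
  refine ⟨(f 1)⁻¹ • f.toLinearMap, fun u hu => ?_, ?_, fun p => ?_⟩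
  · exact mul_nonneg_of_nonpos_of_nonpos (inv_nonpos.2 hf1'.le) (hpos u hu)
  · exact inv_mul_cancel₀ hf1'.ne
  · set S := (f 1)⁻¹ * f (polydiskNormSq p) with hS
    change ‖ψ p‖ ^ 2 ≤ S
    have hS0 : 0 ≤ S := mul_nonneg_of_nonpos_of_nonpos (inv_nonpos.2 hf1'.le)
      (hpos _ fun z => sq_nonneg _)
    rcases eq_or_ne (ψ p) 0 with h0 | h0
    · simpa [h0] using hS0
    have hA0 : 0 < ‖ψ p‖ ^ 2 := by positivity
    -- Rescaling to `ψ (c • p) = 1` turns the linearised inequality back into the quadratic one.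
    set c : ℂ := (((‖ψ p‖ ^ 2)⁻¹ : ℝ) : ℂ) * (starRingEnd ℂ) (ψ p) with hc
    have hψc : ψ (c • p) = 1 := by
      rw [map_smul, smul_eq_mul, hc, mul_assoc, Complex.conj_mul']
      rw [← Complex.ofReal_pow, ← Complex.ofReal_mul, inv_mul_cancel₀ hA0.ne', Complex.ofReal_one]
    have hcn : ‖c‖ ^ 2 = (‖ψ p‖ ^ 2)⁻¹ := by
      rw [hc, norm_mul, RCLike.norm_conj, Complex.norm_real, Real.norm_of_nonneg (by positivity)]
      field_simp
    have hsq : polydiskNormSq (c • p) = (‖c‖ ^ 2) • polydiskNormSq p := by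
      ext z
      simp [polydiskNormSq_apply, smul_eval, mul_pow]
    have h := hfA (c • p)
    rw [hψc, hsq, map_smul, smul_eq_mul, hcn, Complex.one_re] at h
    have hfS : f (polydiskNormSq p) = f 1 * S := by
      rw [hS, mul_inv_cancel_left₀ hf1'.ne]
    rw [hfS] at h
    have h' : 1 ≤ (‖ψ p‖ ^ 2)⁻¹ * S := by
      by_contra! hlt
      nlinarith
    rwa [inv_mul_eq_div, le_div_iff₀ hA0, one_mul] at h'

end State

/-! ### Hilbertian seminorms and the representations they carry. -/

/-- The square of a Hilbertian seminorm. -/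
structure IsHilbertGauge {V : Type*} [AddCommGroup V] [Module ℂ V] (F : V → ℝ) : Prop where
  nonneg : ∀ x, 0 ≤ F x
  smul_le : ∀ (c : ℂ) x, F (c • x) ≤ ‖c‖ ^ 2 * F x
  add_le : ∀ x y (t : ℝ), 0 < t → F (x + y) ≤ (1 + t) * F x + (1 + t⁻¹) * F y
  parallelogram_le : ∀ x y, F (x + y) + F (x - y) ≤ 2 * F x + 2 * F y

theorem norm_add_sq_le_of_pos (x y : ℂ) {t : ℝ} (ht : 0 < t) :
    ‖x + y‖ ^ 2 ≤ (1 + t) * ‖x‖ ^ 2 + (1 + t⁻¹) * ‖y‖ ^ 2 := by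
  refine (pow_le_pow_left₀ (norm_nonneg _) (norm_add_le x y) 2).trans ?_
  have h : (1 + t) * ‖x‖ ^ 2 + (1 + t⁻¹) * ‖y‖ ^ 2 - (‖x‖ + ‖y‖) ^ 2 =
      t⁻¹ * (t * ‖x‖ - ‖y‖) ^ 2 := by
    field_simp
    ring
  have : 0 ≤ t⁻¹ * (t * ‖x‖ - ‖y‖) ^ 2 := by positivity
  linarith

namespace IsHilbertGauge

variable {V : Type*} [AddCommGroup V] [Module ℂ V] {F G : V → ℝ}

theorem smul_eq (hF : IsHilbertGauge F) (c : ℂ) (x : V) : F (c • x) = ‖c‖ ^ 2 * F x := by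
  refine le_antisymm (hF.smul_le c x) ?_
  rcases eq_or_ne c 0 with rfl | hc
  · simpa using hF.nonneg _
  · have := hF.smul_le c⁻¹ (c • x)
    rwa [smul_smul, inv_mul_cancel₀ hc, one_smul, norm_inv, inv_pow, inv_mul_eq_div,
      le_div_iff₀ (by positivity), mul_comm] at this

theorem map_zero (hF : IsHilbertGauge F) : F 0 = 0 := by
  simpa using hF.smul_eq 0 0

theorem map_neg (hF : IsHilbertGauge F) (x : V) : F (-x) = F x := by
  simpa using hF.smul_eq (-1) x

/-- The reverse inequality is `parallelogram_le` applied to `x + y` and `x - y`. -/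
theorem parallelogram (hF : IsHilbertGauge F) (x y : V) :
    F (x + y) + F (x - y) = 2 * F x + 2 * F y := by
  refine le_antisymm (hF.parallelogram_le x y) ?_
  have h := hF.parallelogram_le (x + y) (x - y)
  have hx := hF.smul_eq 2 x
  have hy := hF.smul_eq 2 y
  rw [two_smul] at hx hy
  rw [show x + y + (x - y) = x + x by abel, show x + y - (x - y) = y + y by abel, hx, hy] at h
  norm_num at h
  linarith

/-- The near-optimal `t = b / a` in `add_le` recovers the triangle inequality; `ε / 2` keeps `a` and
`b` positive. The form with `t` is linear in `F`, so it survives sums, positive functionals and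
quotients. -/
theorem sqrt_add_le (hF : IsHilbertGauge F) (x y : V) : √(F (x + y)) ≤ √(F x) + √(F y) := by
  refine le_of_forall_pos_le_add fun ε hε => ?_
  set a := √(F x) + ε / 2
  set b := √(F y) + ε / 2
  have ha : 0 < a := by positivity
  have hb : 0 < b := by positivity
  have hFa : F x ≤ a ^ 2 := (Real.sqrt_le_left ha.le).1 (by simp only [a]; linarith)
  have hFb : F y ≤ b ^ 2 := (Real.sqrt_le_left hb.le).1 (by simp only [b]; linarith)
  have h : F (x + y) ≤ (a + b) ^ 2 := by
    refine (hF.add_le x y (b / a) (by positivity)).trans ?_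
    have h1 : (1 + b / a) * F x ≤ (1 + b / a) * a ^ 2 := by gcongr
    have h2 : (1 + (b / a)⁻¹) * F y ≤ (1 + (b / a)⁻¹) * b ^ 2 := by gcongr
    refine (add_le_add h1 h2).trans_eq ?_
    field_simp
    ring
  refine (Real.sqrt_le_left (by positivity)).2 h |>.trans ?_
  simp only [a, b]
  linarith

theorem add (hF : IsHilbertGauge F) (hG : IsHilbertGauge G) :
    IsHilbertGauge fun x => F x + G x where
  nonneg x := add_nonneg (hF.nonneg x) (hG.nonneg x)
  smul_le c x := by linarith [hF.smul_le c x, hG.smul_le c x]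
  add_le x y t ht := by linarith [hF.add_le x y t ht, hG.add_le x y t ht]
  parallelogram_le x y := by linarith [hF.parallelogram_le x y, hG.parallelogram_le x y]

/-- A definite Hilbertian gauge makes a finite-dimensional module over an algebra into a Hilbert
space carrying a representation of the algebra. -/
theorem exists_representation {A : Type*} [Ring A] [Algebra ℂ A] {V : Type} [AddCommGroup V]
    [Module ℂ V] [FiniteDimensional ℂ V] {F : V → ℝ} (hF : IsHilbertGauge F)
    (hdef : ∀ x, F x = 0 → x = 0) (ρ : A →ₐ[ℂ] Module.End ℂ V) :
    ∃ (H : Type) (_ : NormedAddCommGroup H) (_ : InnerProductSpace ℂ H) (_ : CompleteSpace H)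
      (π : A →ₐ[ℂ] (H →L[ℂ] H)),
      (∀ w c, 0 ≤ c → (∀ x, F (ρ w x) ≤ c ^ 2 * F x) → ‖π w‖ ≤ c) ∧
      ∀ w x, F (ρ w x) ≤ ‖π w‖ ^ 2 * F x := by
  let i₁ : NormedAddCommGroup V := AddGroupNorm.toNormedAddCommGroup
    { toFun := fun x => √(F x)
      map_zero' := by simp [hF.map_zero]
      add_le' := hF.sqrt_add_le
      neg' := fun x => by rw [hF.map_neg]
      eq_zero_of_map_eq_zero' := fun x hx => hdef x ((Real.sqrt_eq_zero (hF.nonneg x)).1 hx) }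
  have hnorm : ∀ x : V, ‖x‖ = √(F x) := fun _ => rfl
  have hsq : ∀ x : V, ‖x‖ ^ 2 = F x := fun x => Real.sq_sqrt (hF.nonneg x)
  let i₂ : NormedSpace ℂ V :=
    { norm_smul_le := fun c x => by
        rw [hnorm, hnorm, hF.smul_eq, Real.sqrt_mul (sq_nonneg _), Real.sqrt_sq (norm_nonneg _)] }
  let i₃ : InnerProductSpace ℂ V := InnerProductSpace.ofNorm ℂ fun x y => by
    simp only [← pow_two, hsq]
    rw [hF.parallelogram]
    ring
  have i₄ : CompleteSpace V := FiniteDimensional.complete ℂ V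
  let e : Module.End ℂ V ≃ₐ[ℂ] (V →L[ℂ] V) := Module.End.toContinuousLinearMap V
  refine ⟨V, i₁, i₃, i₄, (e : Module.End ℂ V →ₐ[ℂ] (V →L[ℂ] V)).comp ρ, fun w c hc h => ?_,
    fun w x => ?_⟩
  · refine ContinuousLinearMap.opNorm_le_bound _ hc fun x => ?_
    refine le_of_sq_le_sq ?_ (by positivity)
    rw [mul_pow, hsq, hsq]
    exact h x
  · rw [← hsq, ← hsq, ← mul_pow]
    exact pow_le_pow_left₀ (norm_nonneg _)
      (ContinuousLinearMap.le_opNorm ((e : Module.End ℂ V →ₐ[ℂ] (V →L[ℂ] V)).comp ρ w) x) 2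

end IsHilbertGauge

theorem isHilbertGauge_sum_norm_sq {k : ℕ} {ε : ℝ} (hε : 0 ≤ ε) :
    IsHilbertGauge fun x : Fin k → ℂ => ε * ∑ i, ‖x i‖ ^ 2 where
  nonneg x := by positivity
  smul_le c x := by
    simp only [Pi.smul_apply, norm_smul, mul_pow, ← Finset.mul_sum]
    exact (mul_left_comm _ _ _).le
  add_le x y t ht := by
    have h : ∑ i, ‖(x + y) i‖ ^ 2 ≤ (1 + t) * ∑ i, ‖x i‖ ^ 2 + (1 + t⁻¹) * ∑ i, ‖y i‖ ^ 2 := by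
      rw [Finset.mul_sum, Finset.mul_sum, ← Finset.sum_add_distrib]
      exact Finset.sum_le_sum fun i _ => norm_add_sq_le_of_pos _ _ ht
    linarith [mul_le_mul_of_nonneg_left h hε]
  parallelogram_le x y := by
    have h : ∑ i, ‖(x + y) i‖ ^ 2 + ∑ i, ‖(x - y) i‖ ^ 2 ≤
        2 * ∑ i, ‖x i‖ ^ 2 + 2 * ∑ i, ‖y i‖ ^ 2 := by
      rw [Finset.mul_sum, Finset.mul_sum, ← Finset.sum_add_distrib, ← Finset.sum_add_distrib]
      refine Finset.sum_le_sum fun i _ => ?_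
      have := parallelogram_law_with_norm ℂ (x i) (y i)
      simp only [Pi.add_apply, Pi.sub_apply]
      nlinarith
    linarith [mul_le_mul_of_nonneg_left h hε]

/-! ### The quotient of the `L²` seminorm of a state. -/

section StateGauge

variable {n k : ℕ}

/-- The quotient of the `L²` seminorm of a state, squared. -/
noncomputable def stateGauge (m : C(closedPolydisk n, ℝ) →ₗ[ℝ] ℝ) (g : Fin n → Fin k → ℂ)
    (w : Fin k → ℂ) : ℝ :=
  ⨅ p : {p : MvPolynomial (Fin n) ℂ // aeval g p = w}, m (polydiskNormSq p.1)

variable {m : C(closedPolydisk n, ℝ) →ₗ[ℝ] ℝ} {g : Fin n → Fin k → ℂ}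

theorem stateGauge_aeval_le (hm : ∀ u, 0 ≤ u → 0 ≤ m u) (p : MvPolynomial (Fin n) ℂ) :
    stateGauge m g (aeval g p) ≤ m (polydiskNormSq p) :=
  ciInf_le ⟨0, by rintro _ ⟨q, rfl⟩; exact hm _ fun z => sq_nonneg _⟩
    (⟨p, rfl⟩ : {q : MvPolynomial (Fin n) ℂ // aeval g q = aeval g p})

theorem exists_of_stateGauge_lt
    (hs : Function.Surjective (aeval g : MvPolynomial (Fin n) ℂ →ₐ[ℂ] (Fin k → ℂ)))
    {w : Fin k → ℂ} {c : ℝ} (h : stateGauge m g w < c) :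
    ∃ p : MvPolynomial (Fin n) ℂ, aeval g p = w ∧ m (polydiskNormSq p) < c := by
  obtain ⟨p, hp⟩ := hs w
  have : Nonempty {p : MvPolynomial (Fin n) ℂ // aeval g p = w} := ⟨⟨p, hp⟩⟩
  obtain ⟨⟨q, hq⟩, hlt⟩ := exists_lt_of_ciInf_lt h
  exact ⟨q, hq, hlt⟩

theorem le_map_of_le (hm : ∀ u, 0 ≤ u → 0 ≤ m u) {u v : C(closedPolydisk n, ℝ)}
    (h : ∀ z, u z ≤ v z) : m u ≤ m v := by
  have := hm (v - u) fun z => by simpa using h z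
  rw [map_sub] at this
  linarith

theorem isHilbertGauge_stateGauge (hm : ∀ u, 0 ≤ u → 0 ≤ m u)
    (hs : Function.Surjective (aeval g : MvPolynomial (Fin n) ℂ →ₐ[ℂ] (Fin k → ℂ))) :
    IsHilbertGauge (stateGauge m g) where
  nonneg w := Real.iInf_nonneg fun p => hm _ fun z => sq_nonneg _
  smul_le c w := by
    refine le_of_forall_pos_le_add fun ε hε => ?_
    obtain ⟨p, rfl, hp⟩ := exists_of_stateGauge_lt hs
      (lt_add_of_pos_right (stateGauge m g w) (by positivity : 0 < ε / (‖c‖ ^ 2 + 1)))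
    rw [← map_smul]
    have hsq : polydiskNormSq (c • p) = (‖c‖ ^ 2) • polydiskNormSq p := by
      ext z
      simp [polydiskNormSq_apply, smul_eval, mul_pow]
    refine (stateGauge_aeval_le hm _).trans ?_
    rw [hsq, map_smul, smul_eq_mul]
    refine (mul_le_mul_of_nonneg_left hp.le (sq_nonneg _)).trans ?_
    rw [mul_add]
    gcongr
    rw [mul_div_assoc', div_le_iff₀ (by positivity)]
    nlinarith [sq_nonneg ‖c‖]
  add_le x y t ht := by
    refine le_of_forall_pos_le_add fun ε hε => ?_
    obtain ⟨p, rfl, hp⟩ := exists_of_stateGauge_lt hs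
      (lt_add_of_pos_right (stateGauge m g x) (by positivity : 0 < ε / (2 * (1 + t))))
    obtain ⟨q, rfl, hq⟩ := exists_of_stateGauge_lt hs
      (lt_add_of_pos_right (stateGauge m g y) (by positivity : 0 < ε / (2 * (1 + t⁻¹))))
    rw [← map_add]
    refine (stateGauge_aeval_le hm _).trans ?_
    have h1 : m (polydiskNormSq (p + q)) ≤
        m ((1 + t) • polydiskNormSq p + (1 + t⁻¹) • polydiskNormSq q) :=
      le_map_of_le hm fun z => by
        simp only [polydiskNormSq_apply, ContinuousMap.add_apply, ContinuousMap.smul_apply,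
          smul_eq_mul, map_add]
        exact norm_add_sq_le_of_pos _ _ ht
    rw [map_add, map_smul, map_smul, smul_eq_mul, smul_eq_mul] at h1
    have h2 := mul_le_mul_of_nonneg_left hp.le (by positivity : 0 ≤ 1 + t)
    have h3 := mul_le_mul_of_nonneg_left hq.le (by positivity : 0 ≤ 1 + t⁻¹)
    have h4 : (1 + t) * (ε / (2 * (1 + t))) = ε / 2 := by field_simp
    have h5 : (1 + t⁻¹) * (ε / (2 * (1 + t⁻¹))) = ε / 2 := by field_simp
    rw [mul_add, h4] at h2
    rw [mul_add, h5] at h3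
    linarith
  parallelogram_le x y := by
    refine le_of_forall_pos_le_add fun ε hε => ?_
    obtain ⟨p, rfl, hp⟩ := exists_of_stateGauge_lt hs
      (lt_add_of_pos_right (stateGauge m g x) (by positivity : 0 < ε / 4))
    obtain ⟨q, rfl, hq⟩ := exists_of_stateGauge_lt hs
      (lt_add_of_pos_right (stateGauge m g y) (by positivity : 0 < ε / 4))
    rw [← map_add, ← map_sub]
    refine (add_le_add (stateGauge_aeval_le hm _) (stateGauge_aeval_le hm _)).trans ?_
    have h1 : polydiskNormSq (p + q) + polydiskNormSq (p - q) =
        (2 : ℝ) • polydiskNormSq p + (2 : ℝ) • polydiskNormSq q := by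
      ext z
      have := parallelogram_law_with_norm ℂ (eval z.1 p) (eval z.1 q)
      simp only [polydiskNormSq_apply, ContinuousMap.add_apply, ContinuousMap.smul_apply,
        smul_eq_mul, map_add, map_sub]
      nlinarith
    rw [← map_add, h1, map_add, map_smul, map_smul, smul_eq_mul, smul_eq_mul]
    linarith

/-- Multiplication by `g j` lifts to multiplication by `X j`, and `|z j| ≤ 1` on the polydisk. -/
theorem stateGauge_generator_mul_le (hm : ∀ u, 0 ≤ u → 0 ≤ m u)
    (hs : Function.Surjective (aeval g : MvPolynomial (Fin n) ℂ →ₐ[ℂ] (Fin k → ℂ))) (j : Fin n)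
    (w : Fin k → ℂ) : stateGauge m g (g j * w) ≤ stateGauge m g w := by
  refine le_of_forall_gt fun c hc => ?_
  obtain ⟨p, rfl, hp⟩ := exists_of_stateGauge_lt hs hc
  have h : g j * aeval g p = aeval g (X j * p) := by rw [map_mul, aeval_X]
  rw [h]
  refine ((stateGauge_aeval_le hm _).trans (le_map_of_le hm fun z => ?_)).trans_lt hp
  simp only [polydiskNormSq_apply, map_mul, eval_X, norm_mul, mul_pow]
  exact mul_le_of_le_one_left (sq_nonneg _) (pow_le_one₀ (norm_nonneg _) (z.2 j))

end StateGauge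

/-! ### The operator algebra hull of a pair lies in its hyperconvex hull. -/

theorem AlgebraNorm.exists_dual {k : ℕ} (N : AlgebraNorm ℂ (Fin k → ℂ)) {v : Fin k → ℂ}
    (hv : v ≠ 0) : ∃ φ : (Fin k → ℂ) →ₗ[ℂ] ℂ, (∀ w, ‖φ w‖ ≤ N w) ∧ φ v = N v := by
  obtain ⟨φ, hφ, hle⟩ := Module.Dual.exists_extension_of_le_seminorm (Submodule.span ℂ {v})
    ((N v : ℂ) • (LinearEquiv.coord ℂ (Fin k → ℂ) v hv).toLinearMap) (p := N.toSeminorm)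
    (fun x => by
      have h : N (x : Fin k → ℂ) = ‖LinearEquiv.coord ℂ (Fin k → ℂ) v hv x‖ * N v := by
        rw [← map_smul_eq_mul, LinearEquiv.coord_apply_smul]
      refine le_of_eq ?_
      change _ = N x
      rw [h]
      simp [mul_comm, abs_of_nonneg (apply_nonneg N v)])
  refine ⟨φ, hle, ?_⟩
  have := hφ ⟨v, Submodule.mem_span_singleton_self v⟩
  rw [this]
  simp [LinearEquiv.coord_self]

/-- If `N v > 1`, the gauge of a state dominating a norming functional gives a representation with
`a` and `b` contractive but `‖π v‖ > 1`. -/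
theorem operatorAlgebraBallGen_subset {k : ℕ} {a b : Fin k → ℂ} (ha : a ∈ closedPolydisk k)
    (hb : b ∈ closedPolydisk k) {N : AlgebraNorm ℂ (Fin k → ℂ)} (hN1 : N 1 = 1)
    (hN : SatisfiesMultivariableVonNeumann N) (hNa : N a ≤ 1) (hNb : N b ≤ 1) {v : Fin k → ℂ}
    (hv : ∀ M : AlgebraNorm ℂ (Fin k → ℂ), M 1 = 1 → HasHilbertRepresentation M →
      M a ≤ 1 → M b ≤ 1 → M v ≤ 1) : N v ≤ 1 := by
  by_contra! hlt
  have hv0 : v ≠ 0 := by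
    rintro rfl
    rw [map_zero] at hlt
    linarith
  have h10 : (1 : Fin k → ℂ) ≠ 0 := fun h => by
    rw [h, map_zero] at hN1
    exact zero_ne_one hN1
  obtain ⟨φ, hφ, hφv⟩ := N.exists_dual hv0
  -- One fixed scale suffices here: the idempotents only have to lie in the unit ball of `N`.
  obtain ⟨r, hr0, hr1, hr⟩ : ∃ r : ℝ, 0 < r ∧ r ≤ 1 ∧ ∀ i, N (Pi.single i (r : ℂ)) ≤ 1 := by
    set C := ∑ i, N (Pi.single i 1) with hC
    have hC0 : 0 ≤ C := Finset.sum_nonneg fun i _ => apply_nonneg N _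
    refine ⟨(1 + C)⁻¹, by positivity, inv_le_one_of_one_le₀ (by linarith), fun i => ?_⟩
    refine (N.le_mul_sup _ (c := (1 + C)⁻¹) fun l => ?_).trans ?_
    · rw [Pi.single_apply]
      split_ifs
      · rw [Complex.norm_real, Real.norm_of_nonneg (by positivity)]
      · rw [norm_zero]
        positivity
    · rw [← hC, ← div_eq_mul_inv, div_le_one (by positivity)]
      linarith
  set g := extendedTuple a b r with hg
  have hs := aeval_extendedTuple_surjective a b hr0.ne'
  rw [← hg] at hs
  have hNg : ∀ j, N (g j) ≤ 1 := fun j => Fin.cases hNa (fun j => Fin.cases hNb hr j) j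
  obtain ⟨m, hm, hm1, hmφ⟩ := exists_state_norm_sq_le
    (φ ∘ₗ (aeval g : MvPolynomial (Fin (k + 2)) ℂ →ₐ[ℂ] (Fin k → ℂ)).toLinearMap)
    fun p => (hφ _).trans (hN _ g hNg p)
  have hφF : ∀ w, ‖φ w‖ ^ 2 ≤ stateGauge m g w := fun w => by
    refine le_of_forall_gt fun c hc => ?_
    obtain ⟨p, rfl, hp⟩ := exists_of_stateGauge_lt hs hc
    exact (hmφ p).trans_lt hp
  have hF1 : stateGauge m g 1 ≤ 1 := by
    have h := stateGauge_aeval_le (g := g) hm 1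
    rw [map_one] at h
    refine h.trans ?_
    rw [← hm1]
    exact le_map_of_le hm fun z => by simp [polydiskNormSq_apply]
  -- The Euclidean term must make the gauge definite while keeping its value at `1` below `N v ^ 2`.
  obtain ⟨ε, hε0, hε⟩ : ∃ ε : ℝ, 0 < ε ∧ 1 + ε * k < N v ^ 2 := by
    refine ⟨(N v ^ 2 - 1) / (2 * (k + 1)), ?_, ?_⟩
    · have : 0 < N v ^ 2 - 1 := by nlinarith
      positivity
    · rw [div_mul_eq_mul_div, ← lt_sub_iff_add_lt', div_lt_iff₀ (by positivity)]
      have : 0 < N v ^ 2 - 1 := by nlinarith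
      nlinarith [(Nat.cast_nonneg k : (0 : ℝ) ≤ k)]
  let F : (Fin k → ℂ) → ℝ := fun x => stateGauge m g x + ε * ∑ i, ‖x i‖ ^ 2
  have hF : IsHilbertGauge F :=
    (isHilbertGauge_stateGauge hm hs).add (isHilbertGauge_sum_norm_sq hε0.le)
  have hdef : ∀ x, F x = 0 → x = 0 := fun x hx => by
    have h1 := (isHilbertGauge_stateGauge hm hs).nonneg x
    have h2 : 0 ≤ ε * ∑ i, ‖x i‖ ^ 2 := by positivity
    have h3 : ε * ∑ i, ‖x i‖ ^ 2 = 0 := by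
      change stateGauge m g x + ε * ∑ i, ‖x i‖ ^ 2 = 0 at hx
      linarith
    have h4 := (mul_eq_zero.1 h3).resolve_left hε0.ne'
    rw [Finset.sum_eq_zero_iff_of_nonneg fun _ _ => sq_nonneg _] at h4
    ext i
    simpa using h4 i (Finset.mem_univ i)
  have hFg : ∀ j x, F (g j * x) ≤ 1 ^ 2 * F x := fun j x => by
    rw [one_pow, one_mul]
    refine add_le_add (stateGauge_generator_mul_le hm hs j x) ?_
    gcongr with i
    rw [Pi.mul_apply, norm_mul]
    exact mul_le_of_le_one_left (norm_nonneg _)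
      (extendedTuple_mem ha hb (abs_le.2 ⟨by linarith, hr1⟩) j i)
  have hF1' : F 1 ≤ 1 + ε * k := by
    refine add_le_add hF1 ?_
    simp
  have hF1pos : 0 < F 1 := (hF.nonneg 1).lt_of_ne fun h => h10 (hdef 1 h.symm)
  obtain ⟨H, i₁, i₂, i₃, π, hπ, hπ'⟩ := hF.exists_representation hdef (Algebra.lmul ℂ (Fin k → ℂ))
  have hπ1 : ∀ w, F w ≤ ‖π w‖ ^ 2 * F 1 := fun w => by simpa using hπ' w 1
  let M : AlgebraNorm ℂ (Fin k → ℂ) :=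
    { toFun := fun w => ‖π w‖
      map_zero' := by simp
      add_le' := fun x y => by
        rw [map_add]
        exact norm_add_le _ _
      neg' := fun x => by rw [map_neg, norm_neg]
      mul_le' := fun x y => by
        rw [map_mul]
        exact norm_mul_le _ _
      eq_zero_of_map_eq_zero' := fun x hx => hdef x (le_antisymm (by
        have := hπ1 x
        rwa [hx, zero_pow two_ne_zero, zero_mul] at this) (hF.nonneg x))
      smul' := fun c x => by rw [map_smul, norm_smul] }
  have hMg : ∀ j, M (g j) ≤ 1 := fun j => hπ _ 1 zero_le_one (hFg j)
  have hM1 : M 1 = 1 := by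
    refine le_antisymm (hπ 1 1 zero_le_one fun x => by simp) ?_
    have h : F 1 ≤ ‖π 1‖ ^ 2 * F 1 := hπ1 1
    change 1 ≤ ‖π 1‖
    by_contra! hlt
    have : ‖π 1‖ ^ 2 < 1 := pow_lt_one₀ (norm_nonneg _) hlt two_ne_zero
    nlinarith
  have hMv := hv M hM1 ⟨H, i₁, i₂, i₃, π, fun w => rfl⟩ (hMg 0) (hMg 1)
  -- With `‖π v‖ ≤ 1` one would get `N v ^ 2 ≤ F v ≤ F 1 < N v ^ 2`.
  have h1 : ‖φ v‖ ^ 2 ≤ F v := (hφF v).trans (le_add_of_nonneg_right (by positivity))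
  have h2 : F v ≤ F 1 := (hπ1 v).trans
    (mul_le_of_le_one_left hF1pos.le (pow_le_one₀ (norm_nonneg _) hMv))
  rw [hφv, Complex.norm_real, Real.norm_of_nonneg (apply_nonneg N v)] at h1
  linarith

theorem corollary2p36 (k : ℕ) (D : Set (Fin k → ℂ)) (hD : D ⊆ closedPolydisk k)
    (hcard : D.encard ≤ 2) :
    operatorAlgebraBallGen D = hyperconvexBallGen D := by
  obtain ⟨a, b, ha, hb, hab⟩ := exists_pair_of_encard_le_two hD hcard
  ext v
  simp only [operatorAlgebraBallGen, hyperconvexBallGen, Set.mem_sInter, Set.mem_ofPred_eq]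
  constructor
  · rintro hv _ ⟨⟨N, hN1, hN, rfl⟩, hDN⟩
    obtain ⟨hNa, hNb⟩ := (hab N).1 hDN
    exact operatorAlgebraBallGen_subset ha hb hN1 hN hNa hNb fun M hM1 hM hMa hMb =>
      hv _ ⟨⟨M, hM1, hM, rfl⟩, (hab M).2 ⟨hMa, hMb⟩⟩
  · rintro hv _ ⟨⟨N, hN1, hN, rfl⟩, hDN⟩
    obtain ⟨hNa, hNb⟩ := (hab N).1 hDN
    exact hyperconvexBallGen_subset ha hb hN1 hN hNa hNb fun M hM1 hM hMa hMb =>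
      hv _ ⟨⟨M, hM1, hM, rfl⟩, (hab M).2 ⟨hMa, hMb⟩⟩
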